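/- Let $k$ be an algebraically closed field and let $C$ be a curve of compact type over $k$: a complete reduced nodal curve whose dual graph is a tree, so that its irreducible components $C_j$ are nonsingular, and two of them meet in at most one point, transversally. A limit linear series of degree $d$ and dimension $r$ on $C$ consists of a line bundle $L_j$ of degree $d$ on each $C_j$ and an $(r+1)$-dimensional subspace $V_j\subseteq H^0(C_j,L_j)$ for each $j$. For $x\in C_j$ let $u_0(j,x)>\dots>u_r(j,x)\ge 0$ be the $r+1$ orders of vanishing at $x$ of the nonzero sections in $V_j$. It is required that, at every node, where $x\in C_j$ and $y\in C_l$ are identified, $u_t(j,x)+u_{r-t}(l,y)\ge d$ for $t=0,\dots,r$. The series is refined if equality holds for all $t$ at all nodes. Let $\{(L_j,V_j)\}$ be a limit linear series of degree $d$ and dimension $r$ on $C$ and fix a component $C_i$. For $j\ne i$ let $P_{j,i}\in C_j$ be the node of $C$ on $C_j$ in the direction of $C_i$, that is, the one in the closure of the connected component of $C\setminus C_j$ whose closure contains $C_i$. Put $$L_{j,i}=L_j\Big(-u_0(j,P_{j,i})\,P_{j,i}-\sum_{P\ne P_{j,i}}u_r(j,P)\,P\Big)\quad (j\neq i),\qquad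 L_{i,i}=L_i\Big(-\sum_{P}u_r(i,P)\,P\Big),$$ where $P$ runs over the nodes of $C$ on $C_j$ other than $P_{j,i}$, respectively over all nodes of $C$ on $C_i$. Then the $L_{j,i}$ glue: there is a line bundle $L^i$ on $C$ with $L^i|_{C_j}\cong L_{j,i}$ for all $j$. Every such $L^i$ has the following properties. 1. If the series is refined, then $L^i$ has degree $d$ on $C$, that is, $\sum_j\deg(L^i|_{C_j})=d$. 2. For every isomorphism $L^i|_{C_i}\cong L_{i,i}$ there is an $(r+1)$-dimensional space of sections of $L^i|_{C_i}$ that the composite $L^i|_{C_i}\cong L_{i,i}\hookrightarrow L_i$ maps bijectively onto $V_i$. 3. For every $j\ne i$, the restriction $L^i|_{C_j}$ has a nonzero global section. -/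

import Mathlib

open CategoryTheory TopologicalSpace AlgebraicGeometry

universe u

namespace LimitSeries

noncomputable section

section LineBundles

variable {X : Scheme.{u}} (L : X.Modules)

/-- The restriction `s|_V` of a section `s` of `L` over `U` to a smaller open set `V`. -/
def res {U V : X.Opens} (h : V ≤ U) (s : Γ(L, U)) : Γ(L, V) :=
  L.presheaf.map (homOfLE h).op s

lemma res_res {U V W : X.Opens} (h : V ≤ U) (h' : W ≤ V) (s : Γ(L, U)) :
    res L h' (res L h s) = res L (h'.trans h) s := by
  simp only [res, ← ConcreteCategory.comp_apply, ← Functor.map_comp]; rfl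

lemma res_add {U V : X.Opens} (h : V ≤ U) (s t : Γ(L, U)) :
    res L h (s + t) = res L h s + res L h t := map_add _ _ _

lemma res_smul {U V : X.Opens} (h : V ≤ U) (a : Γ(X, U)) (s : Γ(L, U)) :
    res L h (a • s) = X.presheaf.map (homOfLE h).op a • res L h s :=
  Scheme.Modules.map_smul L (homOfLE h) a s

/-- `e ∈ Γ(L, U)` is a local generator (a frame) of `L` over `U`: the map of sheaves
`𝒪_U ⟶ L|_U`, `a ↦ a • e`, is an isomorphism. -/
def IsFrame {U : X.Opens} (e : Γ(L, U)) : Prop :=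
  ∀ (V : X.Opens) (h : V ≤ U), Function.Bijective (fun a : Γ(X, V) => a • res L h e)

/-- A line bundle (invertible sheaf): an `𝒪_X`-module that is locally isomorphic to `𝒪_X`. -/
def IsLineBundle : Prop :=
  ∀ x : X, ∃ (U : X.Opens) (e : Γ(L, U)), x ∈ U ∧ IsFrame L e

/-- The section `s` vanishes to order at least `n` at `x`: its germ lies in `𝔪ₓⁿ Lₓ`, that is, on
some neighbourhood `V` of `x` it is a combination of sections of `L` with coefficients whose germs
at `x` lie in `𝔪ₓⁿ`. -/
def VanishesToOrder {U : X.Opens} (s : Γ(L, U)) (x : X) (n : ℕ) : Prop :=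
  ∃ (V : X.Opens) (h : V ≤ U) (hx : x ∈ V), res L h s ∈
    ((IsLocalRing.maximalIdeal (X.presheaf.stalk x)) ^ n).comap (X.presheaf.germ V x hx).hom •
      (⊤ : Submodule Γ(X, V) Γ(L, V))

lemma vanishesToOrder_aux {V W : X.Opens} (h : W ≤ V) {x : X} (hx : x ∈ W) (n : ℕ)
    {t : Γ(L, V)} (ht : t ∈
    ((IsLocalRing.maximalIdeal (X.presheaf.stalk x)) ^ n).comap (X.presheaf.germ V x (h hx)).hom •
      (⊤ : Submodule Γ(X, V) Γ(L, V))) : res L h t ∈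
    ((IsLocalRing.maximalIdeal (X.presheaf.stalk x)) ^ n).comap (X.presheaf.germ W x hx).hom •
      (⊤ : Submodule Γ(X, W) Γ(L, W)) := by
  refine Submodule.smul_induction_on ht ?_ ?_
  · intro a ha m _
    rw [res_smul]
    refine Submodule.smul_mem_smul ?_ trivial
    rw [Ideal.mem_comap] at ha ⊢
    convert ha using 1
    exact X.presheaf.germ_res_apply (homOfLE h) x hx a
  · intro a b ha hb
    rw [res_add]; exact add_mem ha hb

lemma VanishesToOrder.res {U V : X.Opens} (h : V ≤ U) {s : Γ(L, U)} {x : X} (hx : x ∈ V) {n : ℕ}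
    (hs : VanishesToOrder L s x n) : VanishesToOrder L (res L h s) x n := by
  obtain ⟨W, hW, hxW, H⟩ := hs
  refine ⟨V ⊓ W, inf_le_left, ⟨hx, hxW⟩, ?_⟩
  have := vanishesToOrder_aux L (inf_le_right : V ⊓ W ≤ W) ⟨hx, hxW⟩ n H
  rw [res_res] at this ⊢
  exact this

lemma VanishesToOrder.of_res {U V : X.Opens} (h : V ≤ U) {s : Γ(L, U)} {x : X} {n : ℕ}
    (hs : VanishesToOrder L (LimitSeries.res L h s) x n) : VanishesToOrder L s x n := by
  obtain ⟨W, hW, hxW, H⟩ := hs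
  exact ⟨W, hW.trans h, hxW, by rwa [res_res] at H⟩

/-- The sections of `L` over `U` that vanish to order at least `D x` at every `x ∈ U`. -/
def vanishingSubmodule (U : X.Opens) (D : X → ℕ) : Submodule Γ(X, U) Γ(L, U) where
  carrier := {s | ∀ x ∈ U, VanishesToOrder L s x (D x)}
  zero_mem' x hx := ⟨U, le_rfl, hx, by simp [LimitSeries.res]⟩
  add_mem' {s t} hs ht x hx := by
    obtain ⟨V, hV, hxV, H⟩ := hs x hx
    obtain ⟨W, hW, hxW, H'⟩ := ht x hx
    refine ⟨V ⊓ W, inf_le_left.trans hV, ⟨hxV, hxW⟩, ?_⟩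
    have h1 := vanishesToOrder_aux L (inf_le_left : V ⊓ W ≤ V) ⟨hxV, hxW⟩ _ H
    have h2 := vanishesToOrder_aux L (inf_le_right : V ⊓ W ≤ W) ⟨hxV, hxW⟩ _ H'
    rw [res_res] at h1 h2
    rw [res_add]
    exact add_mem h1 h2
  smul_mem' a s hs x hx := by
    obtain ⟨V, hV, hxV, H⟩ := hs x hx
    exact ⟨V, hV, hxV, by rw [res_smul]; exact Submodule.smul_mem _ _ H⟩

/-- The sub-presheaf `U ↦ {s ∈ Γ(L, U) | ord_x s ≥ D x for all x ∈ U}` of `L`. -/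
def twistSubmodule (D : X → ℕ) : PresheafOfModules.Submodule L.val where
  obj U := vanishingSubmodule L U.unop D
  map f _ hs x hx := VanishesToOrder.res L (leOfHom f.unop) hx (hs x (leOfHom f.unop hx))

/-- The sheaf `L(-D)`, `D = ∑ₓ D(x) x`, as the subsheaf of `L` of the sections that vanish to order
at least `D x` at every point `x`. -/
def twistDown (D : X → ℕ) : X.Modules where
  val := (twistSubmodule L D).toPresheafOfModules
  isSheaf := by
    refine (TopCat.Presheaf.isSheaf_iff_isSheafUniqueGluing
      (twistSubmodule L D).toPresheafOfModules.presheaf).mpr ?_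
    intro ι U sf hsf
    obtain ⟨s, hs, hu⟩ := TopCat.Presheaf.IsSheaf.isSheafUniqueGluing
      (F := L.presheaf) L.isSheaf U (fun i => (sf i).1)
      (fun i j => congrArg Subtype.val (hsf i j))
    have hmem : s ∈ vanishingSubmodule L (iSup U) D := by
      intro x hx
      obtain ⟨i, hi⟩ := Opens.mem_iSup.mp hx
      refine VanishesToOrder.of_res L (le_iSup U i) ?_
      have : LimitSeries.res L (le_iSup U i) s = (sf i).1 := hs i
      rw [this]
      exact (sf i).2 x hi
    refine ⟨⟨s, hmem⟩, fun i => Subtype.ext (hs i), fun t ht => Subtype.ext ?_⟩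
    exact hu t.1 (fun i => congrArg Subtype.val (ht i))

/-- The inclusion `L(-D) ⟶ L`. -/
def twistι (D : X → ℕ) : twistDown L D ⟶ L := ⟨(twistSubmodule L D).ι⟩

end LineBundles

section Degree

variable {X : Scheme.{u}} [IsIntegral X] [IsLocallyNoetherian X] (L : X.Modules)

/-- The rational section `s` of `L` (a section over some open set) has order `n ∈ ℤ` at `x`:
for a local generator `e` of `L` near `x` one has `s = b • e` for a nonzero rational function `b`
(given on a non-empty open set `W`), and `b` has order `n` at `x`. -/
def HasRationalOrder {U : X.Opens} (s : Γ(L, U)) (x : X) (n : ℤ) : Prop :=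
  ∃ (V : X.Opens) (e : Γ(L, V)) (W : X.Opens) (hU : W ≤ U) (hV : W ≤ V)
    (hη : genericPoint X ∈ W) (b : Γ(X, W)),
    x ∈ V ∧ IsFrame L e ∧ res L hU s = b • res L hV e ∧ b ≠ 0 ∧
      Scheme.ord (X.presheaf.germ W (genericPoint X) hη b) x = n

/-- `L` has degree `n`, for a line bundle `L` on a nonsingular complete curve over an algebraically
closed field: the divisor `D` of a nonzero rational section of `L` has degree `n`. -/
def HasDegree (n : ℤ) : Prop :=
  ∃ (U : X.Opens) (s : Γ(L, U)) (D : X →₀ ℤ), genericPoint X ∈ U ∧ s ≠ 0 ∧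
    (∀ x, HasRationalOrder L s x (D x)) ∧ D.sum (fun _ m => m) = n

end Degree

section GlobalSections

variable {k : Type u} [Field k] {X : Scheme.{u}} (f : X ⟶ Spec (.of k))

/-- `H⁰(X, L)`, as a vector space over the base field `k` of `f : X ⟶ Spec k`. -/
@[nolint unusedArguments]
def GlobalSections (_f : X ⟶ Spec (.of k)) (L : X.Modules) : Type u := Γ(L, ⊤)

instance (L : X.Modules) : AddCommGroup (GlobalSections f L) :=
  inferInstanceAs (AddCommGroup Γ(L, ⊤))

/-- The ring homomorphism `k → Γ(X, 𝒪_X)` given by the structure morphism. -/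
def scalars : k →+* Γ(X, ⊤) := ((Scheme.ΓSpecIso (.of k)).inv ≫ f.appTop).hom

instance (L : X.Modules) : Module k (GlobalSections f L) :=
  letI : Module Γ(X, ⊤) (GlobalSections f L) := inferInstanceAs (Module Γ(X, ⊤) Γ(L, ⊤))
  Module.compHom _ (scalars f)

/-- The map on global sections induced by a homomorphism of `𝒪_X`-modules. -/
def sectionsMap {L N : X.Modules} (φ : L ⟶ N) : GlobalSections f L → GlobalSections f N :=
  fun s => φ.app ⊤ (s : Γ(L, ⊤))

/-- The set of orders of vanishing at `x` of the sections in `V` (the zero section has none). -/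
def vanishingOrders {L : X.Modules} (V : Submodule k (GlobalSections f L)) (x : X) : Set ℕ :=
  {n | ∃ s ∈ V, VanishesToOrder L (U := ⊤) s x n ∧ ¬ VanishesToOrder L (U := ⊤) s x (n + 1)}

/-- The orders of vanishing at `x` of a linear series `V` of dimension `r + 1`, in decreasing order
`u_0 > ⋯ > u_r`; here `t ≤ r`, and `u_t` is the element of the set of orders of vanishing that has
exactly `r - t` smaller ones. -/
def vanishingOrder {L : X.Modules} (V : Submodule k (GlobalSections f L)) (x : X) (r t : ℕ) : ℕ :=
  Nat.nth (fun n => n ∈ vanishingOrders f V x) (r - t)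

end GlobalSections

/-- A curve of compact type over an algebraically closed field `k`, together with its irreducible
components: a complete reduced nodal curve whose dual graph is a tree (connected, without loops). As
the dual graph has no loops at a vertex, the components are nonsingular; the nodes are then the
points where two components meet, transversally. -/
structure CompactTypeCurve (k : Type u) [Field k] where
  /-- the curve -/
  C : Scheme.{u}
  /-- the structure morphism -/
  str : C ⟶ Spec (.of k)
  [isProper : IsProper str]
  [isReduced : IsReduced C]
  /-- the index set of the irreducible components -/
  Idx : Type
  [fintype : Fintype Idx]
  /-- the irreducible components, with their reduced structure -/
  comp : Idx → Scheme.{u}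
  /-- the inclusions of the components -/
  ι : ∀ j, comp j ⟶ C
  [isClosedImmersion : ∀ j, IsClosedImmersion (ι j)]
  [isIntegral : ∀ j, IsIntegral (comp j)]
  range_injective : Function.Injective fun j => Set.range (ι j)
  range_eq : Set.range (fun j => Set.range (ι j)) = irreducibleComponents C
  /-- the components are nonsingular curves -/
  nonsingular : ∀ (j) (x : comp j), IsClosed ({x} : Set (comp j)) →
    IsDiscreteValuationRing ((comp j).presheaf.stalk x)
  /-- no point lies on three components -/
  two_branches : ∀ (P : C) (j l m : Idx), P ∈ Set.range (ι j) → P ∈ Set.range (ι l) →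
    P ∈ Set.range (ι m) → j = l ∨ j = m ∨ l = m
  /-- two components meet transversally: their scheme-theoretic intersection is reduced -/
  transversal : ∀ j l, j ≠ l → IsReduced (Limits.pullback (ι j) (ι l))
  /-- two components meet in at most one point (the dual graph has no multiple edges) -/
  meet_once : ∀ j l, j ≠ l → (Set.range (ι j) ∩ Set.range (ι l)).Subsingleton
  /-- the dual graph is a tree -/
  isTree : (SimpleGraph.fromRel
    fun j l => (Set.range (ι j) ∩ Set.range (ι l)).Nonempty).IsTree

attribute [instance] CompactTypeCurve.isProper CompactTypeCurve.isReduced CompactTypeCurve.fintype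
  CompactTypeCurve.isClosedImmersion CompactTypeCurve.isIntegral

namespace CompactTypeCurve

variable {k : Type u} [Field k] (Y : CompactTypeCurve k)

/-- The structure morphism of a component. -/
def compStr (j : Y.Idx) : Y.comp j ⟶ Spec (.of k) := Y.ι j ≫ Y.str

instance (j : Y.Idx) : IsLocallyNoetherian (Y.comp j) :=
  haveI : IsNoetherianRing (CommRingCat.of k) := inferInstanceAs (IsNoetherianRing k)
  LocallyOfFiniteType.isLocallyNoetherian (Y.ι j ≫ Y.str)

/-- The restriction of an `𝒪_C`-module to a component. -/
def restrict (L : Y.C.Modules) (j : Y.Idx) : (Y.comp j).Modules :=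
  (Scheme.Modules.pullback (Y.ι j)).obj L

/-- `L` has degree `n` on the curve: the degrees of its restrictions to the components add up
to `n`. -/
def HasTotalDegree (L : Y.C.Modules) (n : ℤ) : Prop :=
  ∃ δ : Y.Idx → ℤ, (∀ j, HasDegree (Y.restrict L j) (δ j)) ∧ ∑ j, δ j = n

/-- The point `x` of the component `C_j` is a node of the curve. -/
def IsNode (j : Y.Idx) (x : Y.comp j) : Prop :=
  ∃ l, l ≠ j ∧ Y.ι j x ∈ Set.range (Y.ι l)

/-- The node `x` of `C_j` is the one towards `C_i`: it lies in the closure of a connected component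
of `C - C_j` whose closure contains `C_i`. (This never happens for `j = i`.) -/
def IsToward (i j : Y.Idx) (x : Y.comp j) : Prop :=
  ∃ y ∈ (Set.range (Y.ι j))ᶜ,
    Set.range (Y.ι i) ⊆ closure (connectedComponentIn (Set.range (Y.ι j))ᶜ y) ∧
      Y.ι j x ∈ closure (connectedComponentIn (Set.range (Y.ι j))ᶜ y)

end CompactTypeCurve

/-- A limit linear series of degree `d` and (projective) dimension `r` on a curve of compact
type. -/
structure LimitLinearSeries {k : Type u} [Field k] (Y : CompactTypeCurve k) (d r : ℕ) where
  /-- the line bundle on each component -/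
  L : ∀ j, (Y.comp j).Modules
  isLineBundle : ∀ j, IsLineBundle (L j)
  hasDegree : ∀ j, HasDegree (L j) d
  /-- the space of sections on each component -/
  V : ∀ j, Submodule k (GlobalSections (Y.compStr j) (L j))
  finrank_V : ∀ j, Module.finrank k (V j) = r + 1
  /-- `u_t + u_{r-t} ≥ d` for the orders of vanishing on the two branches of each node -/
  le_add : ∀ (j l : Y.Idx) (x : Y.comp j) (y : Y.comp l), j ≠ l → Y.ι j x = Y.ι l y → ∀ t ≤ r,
    d ≤ vanishingOrder (Y.compStr j) (V j) x r t + vanishingOrder (Y.compStr l) (V l) y r (r - t)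

namespace LimitLinearSeries

variable {k : Type u} [Field k] {Y : CompactTypeCurve k} {d r : ℕ} (S : LimitLinearSeries Y d r)

/-- The orders of vanishing `u_0(j, x) > ⋯ > u_r(j, x)` of the sections of `V_j` at `x ∈ C_j`. -/
def u (j : Y.Idx) (x : Y.comp j) (t : ℕ) : ℕ := vanishingOrder (Y.compStr j) (S.V j) x r t

/-- The series is refined: `u_t + u_{r-t} = d` at all nodes. -/
def IsRefined : Prop :=
  ∀ (j l : Y.Idx) (x : Y.comp j) (y : Y.comp l), j ≠ l → Y.ι j x = Y.ι l y → ∀ t ≤ r,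
    S.u j x t + S.u l y (r - t) = d

open Classical in
/-- The divisor on `C_j` with coefficient `u_0` at the node towards `C_i`, and `u_r` at the other
nodes. -/
def twistDivisor (i j : Y.Idx) (x : Y.comp j) : ℕ :=
  if Y.IsNode j x then (if Y.IsToward i j x then S.u j x 0 else S.u j x r) else 0

/-- The bundle `L_{j,i}` on `C_j`: the twist of `L_j` by `-u_0` times the node towards `C_i` and
`-u_r` times each of the other nodes. -/
def twist (i j : Y.Idx) : (Y.comp j).Modules := twistDown (S.L j) (S.twistDivisor i j)

/-- The inclusion of `L_{j,i}` in `L_j`. -/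
def twistIncl (i j : Y.Idx) : S.twist i j ⟶ S.L j := twistι (S.L j) (S.twistDivisor i j)

/-- `N` is a line bundle on the whole curve obtained by gluing the `L_{j,i}`, `j ∈ Idx`. -/
def IsGluing (i : Y.Idx) (N : Y.C.Modules) : Prop :=
  IsLineBundle N ∧ ∀ j, Nonempty (Y.restrict N j ≅ S.twist i j)

end LimitLinearSeries

end

end LimitSeries

/-!
The bundle `L^i` is built for arbitrary line bundles `M_j` on the components. Inside the product of
the sheaves `ι_{j*} M_j` take, for each point `x`, a section `σ_x` over a neighbourhood of `x` whose
coordinates are frames of the `M_j`; the neighbourhood contains no node except possibly `x`. No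
function kills `σ_x`, because the curve is reduced. Away from the nodes a component has the same
functions as the curve, so `σ_x` and `σ_y` differ there by invertible functions, and the subsheaf
locally generated by the `σ_x` is a line bundle with frames `σ_x`. Its projection to `ι_{j*} M_j` is
adjoint to a homomorphism from its restriction to `C_j` into `M_j`; this is a homomorphism of line
bundles that takes frames to frames, hence an isomorphism (`exists_glued_lineBundle`).

This applies to the `L_{j,i}`, which are line bundles: near a point `x` of `C_j` a frame `e` of
`L_j` gives the frame `p ^ n • e` of `L_{j,i}`, where `p` is a uniformizer at `x` without other
zeros and `n` is the coefficient of the twisting divisor at `x` (for `n = 0` simply `e`). The same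
frames show that a rational section of `L_j`, restricted to the complement of the nodes, has as a
rational section of `L_{j,i}` the old order minus the coefficient of the twisting divisor, so that
the degree drops by the degree of that divisor (`HasDegree.twistDown`).

The node of `C_j` on `C_l` is the one towards `C_i` iff `l` can be joined to `i` in the dual graph
without passing through `j` (`CompactTypeCurve.isToward_iff`). As the graph is a tree, every `j ≠ i`
has one such neighbour `l`, and every edge is directed to `i` at exactly one of its ends. For a
refined series each node hence contributes `u_0 + u_r = d` to the total degree of the twisting
divisors; there is one node less than components, which leaves total degree `d`
(`LimitLinearSeries.sum_twistDivisor`).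

As `u_r` is the least order of vanishing of sections in `V_j`, all of `V_i` lies in `H⁰(L_{i,i})`,
and a section in `V_j` of order `u_0` at the node towards `C_i` is a nonzero section of `L_{j,i}`.
-/

namespace LimitSeries

/-! ### Frames of sheaves of modules -/

section

variable {X : Scheme.{u}} {L N : X.Modules}

/-- The restriction of a function to a smaller open set. -/
abbrev resO {U V : X.Opens} (h : V ≤ U) (a : Γ(X, U)) : Γ(X, V) := X.presheaf.map (homOfLE h).op a

lemma resO_resO {U V W : X.Opens} (h : V ≤ U) (h' : W ≤ V) (a : Γ(X, U)) :
    resO h' (resO h a) = resO (h'.trans h) a := by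
  simp only [resO, ← ConcreteCategory.comp_apply, ← Functor.map_comp]; rfl

lemma germ_resO {U V : X.Opens} (h : V ≤ U) (x : X) (hx : x ∈ V) (a : Γ(X, U)) :
    X.presheaf.germ V x hx (resO h a) = X.presheaf.germ U x (h hx) a :=
  X.presheaf.germ_res_apply (homOfLE h) x hx a

lemma res_self {U : X.Opens} (s : Γ(L, U)) : res L le_rfl s = s := by
  simp [res]

lemma res_zero {U V : X.Opens} (h : V ≤ U) : res L h (0 : Γ(L, U)) = 0 := map_zero _

lemma app_res (φ : L ⟶ N) {U V : X.Opens} (h : V ≤ U) (s : Γ(L, U)) :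
    φ.app V (res L h s) = res N h (φ.app U s) :=
  ConcreteCategory.congr_hom (φ.mapPresheaf.naturality (homOfLE h).op) s

/-- Two sections that agree locally are equal. -/
lemma eq_of_locally_res_eq {U : X.Opens} {s t : Γ(L, U)}
    (H : ∀ x ∈ U, ∃ (V : X.Opens) (h : V ≤ U), x ∈ V ∧ res L h s = res L h t) : s = t := by
  choose V h hx e using H
  refine TopCat.Sheaf.eq_of_locally_eq' ⟨L.presheaf, L.isSheaf⟩ (fun x : U => V x.1 x.2) U
    (fun x => homOfLE (h x.1 x.2)) (fun x hxU => ?_) s t (fun x => e x.1 x.2)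
  exact Opens.mem_iSup.mpr ⟨⟨x, hxU⟩, hx x hxU⟩

lemma eq_of_locally_resO_eq {U : X.Opens} {s t : Γ(X, U)}
    (H : ∀ x ∈ U, ∃ (V : X.Opens) (h : V ≤ U), x ∈ V ∧ resO h s = resO h t) : s = t := by
  choose V h hx e using H
  refine TopCat.Sheaf.eq_of_locally_eq' X.sheaf (fun x : U => V x.1 x.2) U
    (fun x => homOfLE (h x.1 x.2)) (fun x hxU => ?_) s t (fun x => e x.1 x.2)
  exact Opens.mem_iSup.mpr ⟨⟨x, hxU⟩, hx x hxU⟩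

lemma subsingleton_of_eq_bot {U : X.Opens} (h : U = ⊥) : Subsingleton Γ(L, U) :=
  ⟨fun _ _ => eq_of_locally_res_eq fun x hx => by rw [h] at hx; exact hx.elim⟩

lemma subsingleton_fun_of_eq_bot {U : X.Opens} (h : U = ⊥) : Subsingleton Γ(X, U) :=
  ⟨fun _ _ => eq_of_locally_resO_eq fun x hx => by rw [h] at hx; exact hx.elim⟩

/-- Functions given locally and agreeing on overlaps glue. -/
lemma exists_glue {ι : Type u} {U : X.Opens} (V : ι → X.Opens) (h : ∀ i, V i ≤ U)
    (hU : U ≤ iSup V) (a : ∀ i, Γ(X, V i))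
    (H : ∀ i j, resO (inf_le_left : V i ⊓ V j ≤ V i) (a i) =
      resO (inf_le_right : V i ⊓ V j ≤ V j) (a j)) :
    ∃ b : Γ(X, U), ∀ i, resO (h i) b = a i := by
  obtain ⟨b, hb, -⟩ := TopCat.Sheaf.existsUnique_gluing' X.sheaf V U (fun i => homOfLE (h i)) hU a H
  exact ⟨b, hb⟩

lemma IsFrame.res {U V : X.Opens} (h : V ≤ U) {e : Γ(L, U)} (he : IsFrame L e) :
    IsFrame L (res L h e) := by
  intro W hW
  rw [res_res]
  exact he W _

lemma isFrame_of_eq_bot {U : X.Opens} (h : U = ⊥) (e : Γ(L, U)) : IsFrame L e := by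
  intro V hV
  have hV' : V = ⊥ := le_bot_iff.mp (h ▸ hV)
  have := subsingleton_of_eq_bot (L := L) hV'
  have := subsingleton_fun_of_eq_bot (X := X) hV'
  exact ⟨fun _ _ _ => Subsingleton.elim _ _, fun s => ⟨0, Subsingleton.elim _ _⟩⟩

/-- A section is a frame as soon as no function kills it and it locally generates all sections: the
local coefficients are unique, hence glue. -/
lemma isFrame_of_locally {U : X.Opens} {e : Γ(L, U)}
    (inj : ∀ (V : X.Opens) (h : V ≤ U) (a : Γ(X, V)), a • res L h e = 0 → a = 0)
    (surj : ∀ (V : X.Opens) (h : V ≤ U) (t : Γ(L, V)), ∀ x ∈ V,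
      ∃ (W : X.Opens) (hW : W ≤ V) (a : Γ(X, W)), x ∈ W ∧
        res L hW t = a • res L (hW.trans h) e) : IsFrame L e := by
  have inj' : ∀ (V : X.Opens) (h : V ≤ U),
      Function.Injective (fun a : Γ(X, V) => a • res L h e) := fun V h a b hab =>
    sub_eq_zero.mp (inj V h _ (by rw [sub_smul]; exact sub_eq_zero.mpr hab))
  refine fun V h => ⟨inj' V h, fun t => ?_⟩
  choose W hW a hx ha using surj V h t
  obtain ⟨b, hb⟩ := exists_glue (fun x : V => W x.1 x.2) (fun x => hW x.1 x.2)
    (fun x hxV => Opens.mem_iSup.mpr ⟨⟨x, hxV⟩, hx x hxV⟩) (fun x => a x.1 x.2) (by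
      intro x y
      refine inj' _ (inf_le_left.trans ((hW _ _).trans h)) ?_
      have h1 := congrArg (res L (inf_le_left : W x.1 x.2 ⊓ W y.1 y.2 ≤ _)) (ha x.1 x.2)
      have h2 := congrArg (res L (inf_le_right : W x.1 x.2 ⊓ W y.1 y.2 ≤ _)) (ha y.1 y.2)
      rw [res_res, res_smul, res_res] at h1 h2
      exact h1.symm.trans h2)
  refine ⟨b, eq_of_locally_res_eq fun x hxV => ⟨W x hxV, hW x hxV, hx x hxV, ?_⟩⟩
  rw [ha x hxV, res_smul, res_res, ← hb ⟨x, hxV⟩]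

lemma IsFrame.map_of_isIso (φ : L ⟶ N) [IsIso φ] {U : X.Opens} {e : Γ(L, U)}
    (he : IsFrame L e) : IsFrame N (φ.app U e) := by
  intro V h
  have h1 : (fun a : Γ(X, V) => a • LimitSeries.res N h (φ.app U e)) =
      (φ.app V) ∘ fun a : Γ(X, V) => a • LimitSeries.res L h e := by
    funext a
    simp [← app_res]
  rw [h1]
  refine Function.Bijective.comp ?_ (he V h)
  exact ConcreteCategory.bijective_of_isIso (φ.app V)

/-- A homomorphism of line bundles whose image locally contains a frame is an isomorphism. -/
lemma isIso_of_hits_frames (φ : L ⟶ N) (hL : IsLineBundle L)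
    (H : ∀ x : X, ∃ (U : X.Opens) (s : Γ(L, U)), x ∈ U ∧ IsFrame N (φ.app U s)) : IsIso φ := by
  -- near every point there is a frame of `L` that is mapped to a frame of `N`
  have key : ∀ x : X, ∃ (U : X.Opens) (e : Γ(L, U)), x ∈ U ∧ IsFrame L e ∧
      IsFrame N (φ.app U e) := by
    intro x
    obtain ⟨U, s, hxU, hs⟩ := H x
    obtain ⟨V, e, hxV, he⟩ := hL x
    refine ⟨U ⊓ V, res L inf_le_right e, ⟨hxU, hxV⟩, he.res _, ?_⟩
    obtain ⟨c, hc⟩ := (he (U ⊓ V) inf_le_right).2 (res L inf_le_left s)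
    obtain ⟨t, ht⟩ := (hs (U ⊓ V) inf_le_left).2 (φ.app _ (res L inf_le_right e))
    dsimp only at hc ht
    have hs' := hs.res (inf_le_left : U ⊓ V ≤ U)
    -- `s = c • e` and `φ e = t • φ s`, so that `φ s = c t • φ s`
    have hct : c * t = 1 := by
      refine (hs (U ⊓ V) inf_le_left).1 ?_
      dsimp only
      rw [mul_smul, ht, ← Scheme.Modules.Hom.app_smul, hc, app_res, one_smul]
    have htc : t * c = 1 := by rw [mul_comm]; exact hct
    intro W hW
    have e1 : (fun a : Γ(X, W) => a • res N hW (φ.app _ (res L inf_le_right e))) =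
        (fun a : Γ(X, W) => a • res N (hW.trans inf_le_left) (φ.app U s)) ∘
          fun a => a * resO hW t := by
      funext a
      simp only [Function.comp_apply, ← ht, mul_smul, res_smul, res_res]
    rw [e1]
    refine (hs W _).comp ?_
    have u : IsUnit (resO hW t) := (IsUnit.of_mul_eq_one c htc).map (X.presheaf.map _).hom
    exact ⟨fun a b hab => u.mul_left_injective hab, fun b => ⟨b * ↑u.unit⁻¹, by simp [mul_assoc]⟩⟩
  choose U e hx he hφ using key
  rw [Scheme.Modules.Hom.isIso_iff_isIso_app]
  intro V
  have hinj : ∀ V : X.Opens, Function.Injective (φ.app V) := by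
    intro V
    rw [injective_iff_map_eq_zero]
    intro s hs
    refine eq_of_locally_res_eq fun x hxV => ⟨V ⊓ U x, inf_le_left, ⟨hxV, hx x⟩, ?_⟩
    obtain ⟨a, ha⟩ := (he x (V ⊓ U x) inf_le_right).2 (res L inf_le_left s)
    dsimp only at ha
    rw [res_zero, ← ha]
    have : a = 0 := by
      refine (hφ x (V ⊓ U x) inf_le_right).1 ?_
      dsimp only
      rw [← app_res, ← Scheme.Modules.Hom.app_smul, ha, app_res, hs, res_zero, zero_smul]
    rw [this, zero_smul]
  have : Function.Bijective (φ.app V) := by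
    refine ⟨hinj V, fun t => ?_⟩
    have hex : ∀ x : V, ∃ s : Γ(L, V ⊓ U x.1), φ.app _ s = res N inf_le_left t := by
      intro x
      obtain ⟨a, ha⟩ := (hφ x.1 (V ⊓ U x) inf_le_right).2 (res N inf_le_left t)
      refine ⟨a • res L inf_le_right (e x.1), ?_⟩
      rw [Scheme.Modules.Hom.app_smul, app_res]; exact ha
    choose s hs using hex
    obtain ⟨b, hb, -⟩ := TopCat.Sheaf.existsUnique_gluing' ⟨L.presheaf, L.isSheaf⟩
      (fun x : V => V ⊓ U x.1) V (fun i => homOfLE inf_le_left)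
      (fun x hxV => Opens.mem_iSup.mpr ⟨⟨x, hxV⟩, hxV, hx x⟩) s (by
        intro x y
        refine hinj _ ?_
        refine (app_res φ (inf_le_left) (s x)).trans (.trans ?_ (app_res φ inf_le_right (s y)).symm)
        rw [hs, hs, res_res, res_res])
    refine ⟨b, eq_of_locally_res_eq fun x hxV => ⟨V ⊓ U x, inf_le_left, ⟨hxV, hx x⟩, ?_⟩⟩
    rw [← app_res, ← hs ⟨x, hxV⟩]
    exact congrArg _ (hb ⟨x, hxV⟩)
  exact (ConcreteCategory.isIso_iff_bijective _).mpr this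

end

/-! ### Pullbacks of line bundles -/

section

variable {X Y : Scheme.{u}} {L N : X.Modules}

/-- The structure sheaf as a module over itself. -/
noncomputable abbrev unitModule (X : Scheme.{u}) : X.Modules := SheafOfModules.unit X.ringCatSheaf

/-- A global frame trivialises the sheaf. -/
lemma nonempty_iso_of_isFrame {e : Γ(L, ⊤)} (he : IsFrame L e) : Nonempty (unitModule X ≅ L) := by
  let s : SheafOfModules.sections (R := X.ringCatSheaf) L :=
    PresheafOfModules.sectionsMk (fun U => res L (le_top (a := U.unop)) e) (by
      intro U V f
      exact res_res L le_top (leOfHom f.unop) e)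
  let φ : unitModule X ⟶ L := (SheafOfModules.unitHomEquiv (R := X.ringCatSheaf) L).symm s
  have h1 : ∀ U : X.Opens, φ.app U (1 : Γ(X, U)) = res L le_top e := by
    intro U
    have h2 := (SheafOfModules.unitHomEquiv (R := X.ringCatSheaf) L).apply_symm_apply s
    exact congrFun (congrArg Subtype.val h2) (.op U)
  have : IsIso φ := by
    rw [Scheme.Modules.Hom.isIso_iff_isIso_app]
    intro U
    refine (ConcreteCategory.isIso_iff_bijective _).mpr ?_
    have h2 : ⇑(φ.app U) = fun a : Γ(X, U) => a • res L le_top e := by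
      funext a
      rw [← h1 U]
      refine Eq.trans ?_ (Scheme.Modules.Hom.app_smul φ (a : Γ(X, U)) (1 : Γ(X, U)))
      exact congrArg (φ.app U) (mul_one (M := Γ(X, U)) a).symm
    rw [h2]
    exact he U le_top
  exact ⟨asIso φ⟩

lemma isFrame_unit : IsFrame (unitModule X) (U := ⊤) (1 : Γ(X, ⊤)) := by
  intro V h
  have : (fun a : Γ(X, V) => a • res (unitModule X) h (1 : Γ(X, ⊤))) = fun a : Γ(X, V) => a := by
    funext a
    have h1 : res (unitModule X) h (1 : Γ(X, ⊤)) = (1 : Γ(X, V)) :=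
      map_one (X.presheaf.map (homOfLE h).op).hom
    rw [h1]
    exact mul_one (a : Γ(X, V))
  rw [this]
  exact Function.bijective_id

/-- Sections of `L|_U` over `V` are sections of `L` over the image of `V`; the functions on these
two open sets are identified by `appIso`. -/
lemma restrict_smul {U : X.Opens} (V : U.toScheme.Opens) (a : Γ(U, V)) (s : Γ(L, U.ι ''ᵁ V)) :
    HSMul.hSMul (γ := Γ(L.restrict U.ι, V)) a (show Γ(L.restrict U.ι, V) from s) =
      (U.ι.appIso V).inv a • s := rfl

lemma bijective_smul_restrict_iff {U : X.Opens} (V : U.toScheme.Opens)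
    (s : Γ(L, U.ι ''ᵁ V)) : Function.Bijective (fun a : Γ(U, V) =>
      HSMul.hSMul (γ := Γ(L.restrict U.ι, V)) a (show Γ(L.restrict U.ι, V) from s)) ↔
    Function.Bijective (fun a : Γ(X, U.ι ''ᵁ V) => a • s) := by
  have h : (fun a : Γ(U, V) =>
      HSMul.hSMul (γ := Γ(L.restrict U.ι, V)) a (show Γ(L.restrict U.ι, V) from s)) =
      (fun a : Γ(X, U.ι ''ᵁ V) => a • s) ∘ (U.ι.appIso V).inv := by
    funext a; exact restrict_smul V a s
  rw [h]
  exact Function.Bijective.of_comp_iff _ (ConcreteCategory.bijective_of_isIso (U.ι.appIso V).inv)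

lemma isFrame_restrict {U : X.Opens} {e : Γ(L, U)} (he : IsFrame L e) :
    ∃ e' : Γ(L.restrict U.ι, ⊤), IsFrame (L.restrict U.ι) e' := by
  have hU : U.ι ''ᵁ ⊤ ≤ U := by simp
  refine ⟨(show Γ(L, U.ι ''ᵁ ⊤) from res L hU e), fun V h => ?_⟩
  refine (bijective_smul_restrict_iff V
    (res L (Scheme.Hom.image_mono U.ι h) (res L hU e))).mpr ?_
  rw [res_res]
  exact he _ _

lemma exists_isFrame_of_restrict {U : X.Opens} {e : Γ(L.restrict U.ι, ⊤)}
    (he : IsFrame (L.restrict U.ι) e) : ∃ e' : Γ(L, U), IsFrame L e' := by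
  have hU : U ≤ U.ι ''ᵁ ⊤ := by simp
  refine ⟨res L hU (show Γ(L, U.ι ''ᵁ ⊤) from e), fun V h => ?_⟩
  obtain ⟨W, rfl⟩ : ∃ W, U.ι ''ᵁ W = V :=
    ⟨U.ι ⁻¹ᵁ V, by simpa [Scheme.Hom.image_preimage_eq_opensRange_inf] using h⟩
  rw [res_res]
  exact (bijective_smul_restrict_iff W (res L (Scheme.Hom.image_mono U.ι le_top)
    (show Γ(L, U.ι ''ᵁ ⊤) from e))).mp (he W le_top)

/-- A line bundle is a module that becomes free of rank one on the open subschemes of a cover. -/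
lemma isLineBundle_iff : IsLineBundle L ↔
    ∀ x : X, ∃ U : X.Opens, x ∈ U ∧ Nonempty (unitModule U ≅ L.restrict U.ι) := by
  constructor
  · intro H x
    obtain ⟨U, e, hx, he⟩ := H x
    obtain ⟨e', he'⟩ := isFrame_restrict he
    exact ⟨U, hx, nonempty_iso_of_isFrame he'⟩
  · intro H x
    obtain ⟨U, hx, ⟨φ⟩⟩ := H x
    obtain ⟨e, he⟩ := exists_isFrame_of_restrict (isFrame_unit.map_of_isIso φ.hom)
    exact ⟨U, e, hx, he⟩

/-- The whole space is terminal among the open sets, and preimage preserves it. -/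
instance (f : X ⟶ Y) : (Opens.map f.base).Final where
  out d := by
    refine isConnected_of_isTerminal _ (x := StructuredArrow.mk (Y := (⊤ : Opens Y))
      (homOfLE le_top : d ⟶ (Opens.map f.base).obj ⊤)) ?_
    exact Limits.IsTerminal.ofUniqueHom (fun U => StructuredArrow.homMk (homOfLE le_top) rfl)
      (fun U m => by ext; exact Subsingleton.elim (α := _ ⟶ (⊤ : Opens Y)) _ _)

lemma nonempty_pullback_unit (f : X ⟶ Y) :
    Nonempty ((Scheme.Modules.pullback f).obj (unitModule Y) ≅ unitModule X) :=
  haveI : (SheafOfModules.pushforward.{u} f.toRingCatSheafHom).IsRightAdjoint :=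
    (Scheme.Modules.pullbackPushforwardAdjunction f).isRightAdjoint
  let e : (SheafOfModules.pullback f.toRingCatSheafHom).obj (SheafOfModules.unit Y.ringCatSheaf) ≅
      (SheafOfModules.unit X.ringCatSheaf : SheafOfModules X.ringCatSheaf) :=
    @asIso _ _ _ _ (SheafOfModules.pullbackObjUnitToUnit f.toRingCatSheafHom)
      (SheafOfModules.instIsIsoPullbackObjUnitToUnitOfFinal f.toRingCatSheafHom)
  ⟨e⟩

lemma IsLineBundle.pullback (f : X ⟶ Y) {M : Y.Modules} (hM : IsLineBundle M) :
    IsLineBundle ((Scheme.Modules.pullback f).obj M) := by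
  rw [isLineBundle_iff] at hM ⊢
  intro x
  obtain ⟨U, hx, ⟨φ⟩⟩ := hM (f x)
  obtain ⟨ψ⟩ := nonempty_pullback_unit (f ∣_ U)
  refine ⟨f ⁻¹ᵁ U, hx, ⟨?_⟩⟩
  exact ψ.symm ≪≫ (Scheme.Modules.pullback (f ∣_ U)).mapIso
      (φ ≪≫ (Scheme.Modules.restrictFunctorIsoPullback U.ι).app M) ≪≫
    (Scheme.Modules.pullbackComp (f ∣_ U) U.ι).app M ≪≫
    (Scheme.Modules.pullbackCongr (morphismRestrict_ι f U)).app M ≪≫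
    ((Scheme.Modules.pullbackComp (f ⁻¹ᵁ U).ι f).app M).symm ≪≫
    ((Scheme.Modules.restrictFunctorIsoPullback (f ⁻¹ᵁ U).ι).app _).symm

end

/-! ### Subsheaves generated by local sections -/

section GeneratedSubsheaf

variable {X : Scheme.{u}} (F : X.Modules) (W : X → X.Opens) (σ : ∀ x, Γ(F, W x))
  (hW : ∀ x, x ∈ W x)

/-- The sections of `F` over `U` that near every point `x` are multiples of `σ x`. -/
def generatedSubmodule (U : X.Opens) : Submodule Γ(X, U) Γ(F, U) where
  carrier := {t | ∀ x ∈ U, ∃ (V : X.Opens) (h : V ≤ U) (h' : V ≤ W x) (a : Γ(X, V)),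
    x ∈ V ∧ res F h t = a • res F h' (σ x)}
  zero_mem' x hx := ⟨U ⊓ W x, inf_le_left, inf_le_right, 0, ⟨hx, hW x⟩, by rw [res_zero, zero_smul]⟩
  add_mem' {s t} hs ht x hx := by
    obtain ⟨V, h1, h2, a, hxV, ha⟩ := hs x hx
    obtain ⟨V', h1', h2', b, hxV', hb⟩ := ht x hx
    refine ⟨V ⊓ V', inf_le_left.trans h1, inf_le_left.trans h2,
      resO inf_le_left a + resO inf_le_right b, ⟨hxV, hxV'⟩, ?_⟩
    have e1 := congrArg (res F (inf_le_left : V ⊓ V' ≤ V)) ha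
    have e2 := congrArg (res F (inf_le_right : V ⊓ V' ≤ V')) hb
    rw [res_res, res_smul, res_res] at e1 e2
    rw [res_add, add_smul, e1, e2]
  smul_mem' c s hs x hx := by
    obtain ⟨V, h1, h2, a, hxV, ha⟩ := hs x hx
    exact ⟨V, h1, h2, resO h1 c * a, hxV, by rw [res_smul, ha, mul_smul]⟩

variable {F W σ hW} in
lemma mem_generatedSubmodule_of_res {U V : X.Opens} (h : V ≤ U) {t : Γ(F, U)} {x : X}
    (ht : ∃ (V' : X.Opens) (h' : V' ≤ V) (h'' : V' ≤ W x) (a : Γ(X, V')),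
      x ∈ V' ∧ res F h' (res F h t) = a • res F h'' (σ x)) :
    ∃ (V' : X.Opens) (h' : V' ≤ U) (h'' : V' ≤ W x) (a : Γ(X, V')),
      x ∈ V' ∧ res F h' t = a • res F h'' (σ x) := by
  obtain ⟨V', h', h'', a, hxV', ha⟩ := ht
  exact ⟨V', h'.trans h, h'', a, hxV', by rwa [res_res] at ha⟩

/-- The subpresheaf of `F` locally generated by the sections `σ x`. -/
def generatedPresheaf : PresheafOfModules.Submodule F.val where
  obj U := generatedSubmodule F W σ hW U.unop
  map {U V} f := by
    intro (t : Γ(F, U.unop)) ht x hx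
    obtain ⟨V', h1, h2, a, hxV, ha⟩ := ht x (leOfHom f.unop hx)
    refine ⟨V.unop ⊓ V', inf_le_left, inf_le_right.trans h2, resO inf_le_right a, ⟨hx, hxV⟩, ?_⟩
    have e1 := congrArg (res F (inf_le_right : V.unop ⊓ V' ≤ V')) ha
    rw [res_res, res_smul, res_res] at e1
    exact (res_res F (leOfHom f.unop) inf_le_left t).trans e1

/-- The subsheaf of `F` locally generated by the sections `σ x`. -/
noncomputable def generatedSubsheaf : X.Modules where
  val := (generatedPresheaf F W σ hW).toPresheafOfModules
  isSheaf := by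
    refine (TopCat.Presheaf.isSheaf_iff_isSheafUniqueGluing
      (generatedPresheaf F W σ hW).toPresheafOfModules.presheaf).mpr ?_
    intro ι U sf hsf
    obtain ⟨s, hs, hu⟩ := TopCat.Presheaf.IsSheaf.isSheafUniqueGluing
      (F := F.presheaf) F.isSheaf U (fun i => (sf i).1)
      (fun i j => congrArg Subtype.val (hsf i j))
    have hmem : s ∈ generatedSubmodule F W σ hW (iSup U) := by
      intro x hx
      obtain ⟨i, hi⟩ := Opens.mem_iSup.mp hx
      refine mem_generatedSubmodule_of_res (le_iSup U i) ?_
      have : res F (le_iSup U i) s = (sf i).1 := hs i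
      rw [this]
      exact (sf i).2 x hi
    refine ⟨⟨s, hmem⟩, fun i => Subtype.ext (hs i), fun t ht => Subtype.ext ?_⟩
    exact hu t.1 (fun i => congrArg Subtype.val (ht i))

/-- The inclusion of the subsheaf generated by the `σ x`. -/
noncomputable def generatedSubsheafι : generatedSubsheaf F W σ hW ⟶ F :=
  ⟨(generatedPresheaf F W σ hW).ι⟩

lemma generatedSubsheafι_injective (U : X.Opens) :
    Function.Injective ((generatedSubsheafι F W σ hW).app U) := Subtype.val_injective

lemma generatedSubsheafι_app_mem {U : X.Opens} (s : Γ(generatedSubsheaf F W σ hW, U)) :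
    (generatedSubsheafι F W σ hW).app U s ∈ generatedSubmodule F W σ hW U := s.2

lemma exists_generatedSubsheafι_app_eq {U : X.Opens} {t : Γ(F, U)}
    (ht : t ∈ generatedSubmodule F W σ hW U) :
    ∃ s, (generatedSubsheafι F W σ hW).app U s = t := ⟨⟨t, ht⟩, rfl⟩

/-- If the sections `σ x` are not killed by functions and are locally multiples of each other, then
they are frames of the subsheaf that they generate. -/
lemma exists_isFrame_generatedSubsheaf
    (inj : ∀ (x : X) (V : X.Opens) (h : V ≤ W x) (a : Γ(X, V)), a • res F h (σ x) = 0 → a = 0)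
    (compat : ∀ x, ∀ y ∈ W x, ∃ (V : X.Opens) (h : V ≤ W x) (h' : V ≤ W y) (c c' : Γ(X, V)),
      y ∈ V ∧ res F h' (σ y) = c • res F h (σ x) ∧ res F h (σ x) = c' • res F h' (σ y)) (x : X) :
    ∃ e : Γ(generatedSubsheaf F W σ hW, W x), IsFrame (generatedSubsheaf F W σ hW) e ∧
      (generatedSubsheafι F W σ hW).app (W x) e = σ x := by
  obtain ⟨e, he⟩ := exists_generatedSubsheafι_app_eq F W σ hW (t := σ x) (by
    intro y hy
    obtain ⟨V, h, h', c, c', hyV, -, hc'⟩ := compat x y hy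
    exact ⟨V, h, h', c', hyV, hc'⟩)
  refine ⟨e, isFrame_of_locally ?_ ?_, he⟩
  · intro V h a ha
    refine inj x V h a ?_
    rw [← he, ← app_res, ← Scheme.Modules.Hom.app_smul, ha, map_zero]
  · intro V h t y hy
    obtain ⟨V₁, h₁, h₁', a, hyV₁, ha⟩ := generatedSubsheafι_app_mem F W σ hW t y hy
    obtain ⟨V₂, h₂, h₂', c, c', hyV₂, hc, -⟩ := compat x y (h hy)
    refine ⟨V₁ ⊓ V₂, inf_le_left.trans h₁, resO inf_le_left a * resO inf_le_right c,
      ⟨hyV₁, hyV₂⟩, ?_⟩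
    apply generatedSubsheafι_injective
    rw [app_res, Scheme.Modules.Hom.app_smul, app_res, he]
    have e1 := congrArg (res F (inf_le_left : V₁ ⊓ V₂ ≤ V₁)) ha
    have e2 := congrArg (res F (inf_le_right : V₁ ⊓ V₂ ≤ V₂)) hc
    rw [res_res, res_smul, res_res] at e1 e2
    rw [e1, e2, mul_smul]

end GeneratedSubsheaf

section Products

variable {X : Scheme.{u}} {J : Type} [Finite J] (G : J → X.Modules)

/-- A section of a finite product of modules is a family of sections of the factors. -/
lemma bijective_pi_sections (U : X.Opens) : Function.Bijective
    (fun (s : Γ(∏ᶜ G, U)) (j : J) => (Limits.Pi.π G j).app U s) := by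
  let E : X.Modules ⥤ Ab := Scheme.Modules.toPresheaf X ⋙ (evaluation _ _).obj (.op U)
  have h0 : Limits.PreservesFiniteLimits (Scheme.Modules.toPresheaf X) :=
    Limits.PreservesLimits.preservesFiniteLimits _
  have h0' : Limits.PreservesFiniteLimits ((evaluation (Opens X)ᵒᵖ Ab).obj (.op U)) :=
    Limits.PreservesLimits.preservesFiniteLimits _
  have : Limits.PreservesFiniteLimits E := Limits.comp_preservesFiniteLimits _ _
  have h1 : Function.Bijective (fun (s : ToType (∏ᶜ fun j => E.obj (G j))) (j : J) =>
      Limits.Pi.π (fun j => E.obj (G j)) j s) := by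
    convert (Limits.Concrete.productEquiv (fun j => E.obj (G j))).bijective using 1
    funext s j
    simp
  have h2 := ConcreteCategory.bijective_of_isIso (Limits.PreservesProduct.iso E G).hom
  have h3 := h1.comp h2
  have h4 : (fun (s : ToType (∏ᶜ fun j => E.obj (G j))) (j : J) =>
      Limits.Pi.π (fun j => E.obj (G j)) j s) ∘ (Limits.PreservesProduct.iso E G).hom =
      fun (s : Γ(∏ᶜ G, U)) (j : J) => (Limits.Pi.π G j).app U s := by
    funext s j
    have : (Limits.PreservesProduct.iso E G).hom ≫ Limits.Pi.π (fun j => E.obj (G j)) j =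
      E.map (Limits.Pi.π G j) := by simp
    exact ConcreteCategory.congr_hom this s
  exact h4 ▸ h3

end Products

/-! ### Gluing line bundles along the components of a reduced scheme -/

section Gluing

variable {C : Scheme.{u}} {J : Type} {Z : J → Scheme.{u}} (ι : ∀ j, Z j ⟶ C)

/-- On a reduced scheme a function that vanishes on each of the components is zero. -/
lemma eq_zero_of_app_eq_zero [IsReduced C] (hcov : ∀ x : C, ∃ j, x ∈ Set.range (ι j))
    {V : C.Opens} (a : Γ(C, V)) (h : ∀ j, (ι j).app V a = 0) : a = 0 := by
  rw [← basicOpen_eq_bot_iff, eq_bot_iff]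
  intro x hx
  obtain ⟨j, z, rfl⟩ := hcov x
  have h1 : z ∈ (ι j) ⁻¹ᵁ C.basicOpen a := hx
  rw [Scheme.preimage_basicOpen, h j, Scheme.basicOpen_zero] at h1
  exact h1.elim

/-- Away from the other components, a component has the same functions as the whole scheme. -/
lemma bijective_app_of_forall_disjoint [IsReduced C] [∀ j, IsClosedImmersion (ι j)]
    (hcov : ∀ x : C, ∃ j, x ∈ Set.range (ι j)) {j : J} {V : C.Opens}
    (hV : ∀ l ≠ j, ∀ x ∈ V, x ∉ Set.range (ι l)) : Function.Bijective ((ι j).app V) := by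
  have hs : Surjective (ι j ∣_ V) := by
    refine ⟨fun x => ?_⟩
    obtain ⟨l, z, hz⟩ := hcov x.1
    obtain rfl : l = j := by
      by_contra hl
      exact hV l hl x.1 x.2 ⟨z, hz⟩
    refine ⟨⟨z, show ι l z ∈ V from hz ▸ x.2⟩, Subtype.ext ?_⟩
    exact (morphismRestrict_base_coe (ι l) V _).trans hz
  have : IsClosedImmersion (ι j ∣_ V) := inferInstance
  have : IsIso (ι j ∣_ V) := isIso_of_isClosedImmersion_of_surjective _
  have h1 : IsIso ((ι j ∣_ V).app ⊤) := inferInstance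
  have h2 : IsIso ((ι j).app V) := by
    have e := morphismRestrict_appTop (ι j) V
    have h3 : IsIso ((ι j ∣_ V).appTop) := h1
    rw [e] at h3
    have h4 : IsIso ((ι j).app (V.ι ''ᵁ ⊤)) :=
      (@isIso_comp_right_iff _ _ _ _ _ _ _ (Functor.map_isIso _ _)).mp h3
    rwa [Scheme.Opens.ι_image_top] at h4
  exact ConcreteCategory.bijective_of_isIso _

/-- Line bundles on the components have frames over the traces of a common neighbourhood of a point
of `C`. -/
lemma exists_frames [Finite J] [∀ j, IsClosedImmersion (ι j)] {M : ∀ j, (Z j).Modules}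
    (hM : ∀ j, IsLineBundle (M j)) (x : C) :
    ∃ W : C.Opens, x ∈ W ∧ ∀ j, ∃ s : Γ(M j, ι j ⁻¹ᵁ W), IsFrame (M j) s := by
  have h : ∀ j, ∃ W : C.Opens, x ∈ W ∧ ∃ s : Γ(M j, ι j ⁻¹ᵁ W), IsFrame (M j) s := by
    intro j
    by_cases hx : x ∈ Set.range (ι j)
    · obtain ⟨z, rfl⟩ := hx
      obtain ⟨U, e, hz, he⟩ := hM j z
      obtain ⟨W, hW, hWU⟩ := (ι j).isClosedEmbedding.isInducing.isOpen_iff.mp U.isOpen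
      refine ⟨⟨W, hW⟩, ?_, ?_⟩
      · have : z ∈ (ι j) ⁻¹' W := hWU ▸ hz
        exact this
      · have : ι j ⁻¹ᵁ (⟨W, hW⟩ : C.Opens) ≤ U := fun y hy => hWU.le hy
        exact ⟨res (M j) this e, he.res this⟩
    -- off the component the trace is empty, and every section over `⊥` is a frame
    · refine ⟨⟨(Set.range (ι j))ᶜ, (ι j).isClosedEmbedding.isClosed_range.isOpen_compl⟩, hx, 0,
        isFrame_of_eq_bot ?_ _⟩
      rw [eq_bot_iff]
      intro y hy
      exact hy ⟨y, rfl⟩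
  choose W hx s hs using h
  have := Fintype.ofFinite J
  refine ⟨⟨⋂ j, W j, isOpen_iInter_of_finite fun j => (W j).isOpen⟩,
    Set.mem_iInter.mpr hx, fun j => ?_⟩
  have h : ι j ⁻¹ᵁ (⟨⋂ j, W j, isOpen_iInter_of_finite fun j => (W j).isOpen⟩ : C.Opens) ≤
      ι j ⁻¹ᵁ W j := fun y hy => Set.mem_iInter.mp hy j
  exact ⟨res (M j) h (s j), (hs j).res h⟩

/-- Line bundles on the components of a reduced scheme glue to a line bundle, provided that
every point has a neighbourhood whose other points lie on one component only. -/
theorem exists_glued_lineBundle [IsReduced C] [Finite J] [∀ j, IsClosedImmersion (ι j)]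
    (hcov : ∀ x : C, ∃ j, x ∈ Set.range (ι j))
    {M : ∀ j, (Z j).Modules} (hM : ∀ j, IsLineBundle (M j))
    (hloc : ∀ x : C, ∃ W : C.Opens, x ∈ W ∧
      ∀ y ∈ W, y ≠ x → ∃ j, ∀ l ≠ j, y ∉ Set.range (ι l)) :
    ∃ N : C.Modules, IsLineBundle N ∧
      ∀ j, Nonempty ((Scheme.Modules.pullback (ι j)).obj N ≅ M j) := by
  have hex : ∀ x : C, ∃ W : C.Opens, x ∈ W ∧ (∀ y ∈ W, y ≠ x → ∃ j, ∀ l ≠ j, y ∉ Set.range (ι l)) ∧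
      ∀ j, ∃ s : Γ(M j, ι j ⁻¹ᵁ W), IsFrame (M j) s := by
    intro x
    obtain ⟨W₁, hx₁, h₁⟩ := hloc x
    obtain ⟨W₂, hx₂, h₂⟩ := exists_frames ι hM x
    refine ⟨W₁ ⊓ W₂, ⟨hx₁, hx₂⟩, fun y hy => h₁ y hy.1, fun j => ?_⟩
    obtain ⟨s, hs⟩ := h₂ j
    have h : ι j ⁻¹ᵁ (W₁ ⊓ W₂) ≤ ι j ⁻¹ᵁ W₂ := fun y hy => hy.2
    exact ⟨res (M j) h s, hs.res h⟩
  choose W hW hnode s hs using hex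
  let G : J → C.Modules := fun j => (Scheme.Modules.pushforward (ι j)).obj (M j)
  let F : C.Modules := ∏ᶜ G
  have hpi : ∀ x, ∃ σ : Γ(F, W x), ∀ j, (Limits.Pi.π G j).app (W x) σ = s x j := by
    intro x
    obtain ⟨σ, hσ⟩ := (bijective_pi_sections G (W x)).2 (fun j => s x j)
    exact ⟨σ, fun j => congrFun hσ j⟩
  choose σ hσ using hpi
  have hπ : ∀ (x : C) (V : C.Opens) (h : V ≤ W x) (a : Γ(C, V)) (j : J),
      (Limits.Pi.π G j).app V (a • res F h (σ x)) =
        (ι j).app V a • res (M j) (fun _ hx => h hx : ι j ⁻¹ᵁ V ≤ ι j ⁻¹ᵁ W x) (s x j) := by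
    intro x V h a j
    rw [Scheme.Modules.Hom.app_smul, app_res, hσ]
    rfl
  have inj : ∀ (x : C) (V : C.Opens) (h : V ≤ W x) (a : Γ(C, V)), a • res F h (σ x) = 0 →
      a = 0 := by
    intro x V h a ha
    refine eq_zero_of_app_eq_zero ι hcov a fun j => ?_
    have := hπ x V h a j
    rw [ha, map_zero] at this
    refine (hs x j (ι j ⁻¹ᵁ V) (fun _ hx => h hx)).1 ?_
    dsimp only
    rw [zero_smul]
    exact this.symm
  have compat : ∀ x, ∀ y ∈ W x, ∃ (V : C.Opens) (h : V ≤ W x) (h' : V ≤ W y) (c c' : Γ(C, V)),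
      y ∈ V ∧ res F h' (σ y) = c • res F h (σ x) ∧ res F h (σ x) = c' • res F h' (σ y) := by
    intro x y hy
    by_cases hxy : y = x
    · subst hxy
      exact ⟨W y, le_rfl, le_rfl, 1, 1, hy, (one_smul _ _).symm, (one_smul _ _).symm⟩
    -- near `y ≠ x` there is only one component `Z j`, so the quotient of the frames of `M j` is the
    -- restriction of a function on `C`
    obtain ⟨j, hj⟩ := hnode x y hy hxy
    let V₀ : C.Opens := ⟨⋂ l : {l // l ≠ j}, (Set.range (ι l.1))ᶜ, isOpen_iInter_of_finite
      fun l => (ι l.1).isClosedEmbedding.isClosed_range.isOpen_compl⟩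
    have hyV₀ : y ∈ V₀ := Set.mem_iInter.mpr fun l => hj l.1 l.2
    have hle₁ : ∀ x y : C, W x ⊓ W y ⊓ V₀ ≤ W x := fun x y => inf_le_left.trans inf_le_left
    have hle₂ : ∀ x y : C, W x ⊓ W y ⊓ V₀ ≤ W y := fun x y => inf_le_left.trans inf_le_right
    have key : ∀ x y : C, ∃ c : Γ(C, W x ⊓ W y ⊓ V₀),
        res F (hle₂ x y) (σ y) = c • res F (hle₁ x y) (σ x) := by
      intro x y
      have hVl : ∀ l ≠ j, ∀ z ∈ W x ⊓ W y ⊓ V₀, z ∉ Set.range (ι l) := fun l hl z hz =>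
        Set.mem_iInter.mp hz.2 ⟨l, hl⟩
      obtain ⟨b, hb⟩ := (hs x j (ι j ⁻¹ᵁ (W x ⊓ W y ⊓ V₀)) (fun _ h => h.1.1)).2
        (res (M j) (fun _ h => h.1.2) (s y j))
      obtain ⟨c, hc⟩ := (bijective_app_of_forall_disjoint ι hcov hVl).2 b
      refine ⟨c, (bijective_pi_sections G _).1 (funext fun l => ?_)⟩
      dsimp only
      rw [hπ, app_res, hσ]
      by_cases hl : l = j
      · subst hl
        rw [hc]
        exact hb.symm
      · have h0 : ι l ⁻¹ᵁ (W x ⊓ W y ⊓ V₀) = ⊥ :=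
          eq_bot_iff.mpr fun z hz => hVl l hl _ hz ⟨z, rfl⟩
        have := subsingleton_of_eq_bot (L := M l) h0
        exact Subsingleton.elim (α := Γ(M l, _)) _ _
    obtain ⟨c, hc⟩ := key x y
    obtain ⟨c', hc'⟩ := key y x
    have h0 : W x ⊓ W y ⊓ V₀ ≤ W y ⊓ W x ⊓ V₀ := by rw [inf_comm (W x)]
    refine ⟨W x ⊓ W y ⊓ V₀, _, _, c, resO h0 c', ⟨⟨hy, hW y⟩, hyV₀⟩, hc, ?_⟩
    have := congrArg (res F h0) hc'
    rwa [res_smul, res_res, res_res] at this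
  let N : C.Modules := generatedSubsheaf F W σ hW
  have hN := exists_isFrame_generatedSubsheaf F W σ hW inj compat
  have hNL : IsLineBundle N := fun x => by
    obtain ⟨e, he, -⟩ := hN x
    exact ⟨W x, e, hW x, he⟩
  refine ⟨N, hNL, fun j => ?_⟩
  let adj := Scheme.Modules.pullbackPushforwardAdjunction (ι j)
  let q : N ⟶ G j := generatedSubsheafι F W σ hW ≫ Limits.Pi.π G j
  let φ := (adj.homEquiv N (M j)).symm q
  have hφ : adj.unit.app N ≫ (Scheme.Modules.pushforward (ι j)).map φ = q :=
    (adj.homEquiv_unit N (M j) φ).symm.trans ((adj.homEquiv N (M j)).apply_symm_apply q)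
  -- the unit of the adjunction sends the frames `σ x` to sections that `φ` maps to frames of `M j`
  have : IsIso φ := by
    refine isIso_of_hits_frames φ (hNL.pullback (ι j)) fun z => ?_
    obtain ⟨e, he, heσ⟩ := hN (ι j z)
    refine ⟨ι j ⁻¹ᵁ W (ι j z), (adj.unit.app N).app (W (ι j z)) e, hW _, ?_⟩
    have h1 : φ.app _ ((adj.unit.app N).app (W (ι j z)) e) = s (ι j z) j := by
      have h2 : q.app (W (ι j z)) e = s (ι j z) j := by
        rw [Scheme.Modules.Hom.comp_app, ConcreteCategory.comp_apply, heσ, hσ]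
      rw [← hφ] at h2
      exact h2
    rw [h1]
    exact hs _ _
  exact ⟨asIso φ⟩

end Gluing

/-! ### Orders of vanishing and uniformizers -/

section

variable {X : Scheme.{u}} {L : X.Modules}

/-- In terms of a local frame, a section vanishes to order `n` iff its coefficient lies in `𝔪ⁿ`. -/
lemma vanishesToOrder_smul_frame_iff {U V : X.Opens} {e : Γ(L, U)} (he : IsFrame L e) (h : V ≤ U)
    (a : Γ(X, V)) {x : X} (hx : x ∈ V) (n : ℕ) :
    VanishesToOrder L (a • res L h e) x n ↔
      X.presheaf.germ V x hx a ∈ IsLocalRing.maximalIdeal (X.presheaf.stalk x) ^ n := by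
  constructor
  · rintro ⟨W, hW, hxW, H⟩
    -- on `W` the elements of `I • Γ(L, W)` are the multiples of the frame by elements of `I`
    have key : ∀ t ∈ ((IsLocalRing.maximalIdeal (X.presheaf.stalk x)) ^ n).comap
        (X.presheaf.germ W x hxW).hom • (⊤ : Submodule Γ(X, W) Γ(L, W)),
        ∃ c : Γ(X, W), X.presheaf.germ W x hxW c ∈
          IsLocalRing.maximalIdeal (X.presheaf.stalk x) ^ n ∧ t = c • res L (hW.trans h) e := by
      intro t ht
      refine Submodule.smul_induction_on ht ?_ ?_
      · intro b hb m _
        obtain ⟨c, rfl⟩ := (he W (hW.trans h)).2 m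
        refine ⟨b * c, ?_, by rw [mul_smul]⟩
        rw [map_mul]
        exact Ideal.mul_mem_right _ _ hb
      · rintro _ _ ⟨c, hc, rfl⟩ ⟨c', hc', rfl⟩
        exact ⟨c + c', by rw [map_add]; exact add_mem hc hc', by rw [add_smul]⟩
    obtain ⟨c, hc, hce⟩ := key _ H
    rw [res_smul, res_res] at hce
    have := (he W (hW.trans h)).1 hce
    rw [← germ_resO hW x hxW, show resO hW a = c from this]
    exact hc
  · intro ha
    refine ⟨V, le_rfl, hx, ?_⟩
    rw [res_self]
    exact Submodule.smul_mem_smul ha trivial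

section Uniformizer

/-- A generization of a point with discrete valuation local ring is that point or generic. -/
lemma eq_or_eq_genericPoint_of_specializes [IsIntegral X] {x y : X}
    [IsDiscreteValuationRing (X.presheaf.stalk x)] (h : y ⤳ x) : y = x ∨ y = genericPoint X := by
  have hy : y ∈ Set.range (X.fromSpecStalk x) := by rw [Scheme.range_fromSpecStalk]; exact h
  obtain ⟨P, rfl⟩ := hy
  by_cases hP : P.asIdeal = ⊥
  · right
    have hg : genericPoint X ∈ Set.range (X.fromSpecStalk x) := by
      rw [Scheme.range_fromSpecStalk]; exact genericPoint_specializes x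
    obtain ⟨Q, hQ⟩ := hg
    have hPQ : P ⤳ Q := by
      refine (PrimeSpectrum.le_iff_specializes P Q).mp
        ((PrimeSpectrum.asIdeal_le_asIdeal P Q).mp ?_)
      rw [hP]
      exact bot_le
    refine Inseparable.eq
      (((hPQ.map (X.fromSpecStalk x).continuous).trans (specializes_of_eq hQ)).antisymm
      (genericPoint_specializes _))
  · left
    have : P.asIdeal.IsMaximal := P.isPrime.isMaximal hP
    have h2 : P = IsLocalRing.closedPoint _ := PrimeSpectrum.ext (IsLocalRing.eq_maximalIdeal this)
    rw [h2]
    exact Scheme.fromSpecStalk_closedPoint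

lemma isUnit_germ_genericPoint [IsIntegral X] {U : X.Opens} (h : genericPoint X ∈ U) {a : Γ(X, U)}
    (ha : a ≠ 0) : IsUnit (X.presheaf.germ U (genericPoint X) h a) := by
  have h0 : (X.presheaf.germ U (genericPoint X) h a : X.functionField) ≠ 0 := fun h0 =>
    ha (germ_injective_of_isIntegral X _ h (h0.trans (map_zero _).symm))
  exact isUnit_iff_ne_zero.mpr h0

/-- Near a closed point with discrete valuation local ring there is a function that is a uniformizer
there and has no other zero. -/
lemma exists_uniformizer [IsIntegral X] [IsLocallyNoetherian X] {x : X} (hx : IsClosed {x})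
    [IsDiscreteValuationRing (X.presheaf.stalk x)] {U : X.Opens} (hxU : x ∈ U) :
    ∃ (V : X.Opens) (hxV : x ∈ V) (p : Γ(X, V)), V ≤ U ∧
      Irreducible (X.presheaf.germ V x hxV p) ∧
      ∀ (y : X) (hy : y ∈ V), y ≠ x → IsUnit (X.presheaf.germ V y hy p) := by
  obtain ⟨ϖ, hϖ⟩ := IsDiscreteValuationRing.exists_irreducible (X.presheaf.stalk x)
  obtain ⟨U₁, hxU₁, p₁, hp₁⟩ := TopCat.Presheaf.exists_germ_eq X.presheaf ϖ
  obtain ⟨_, ⟨A, hA, rfl⟩, hxA, hAU⟩ := X.isBasis_affineOpens.exists_subset_of_mem_open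
    (show x ∈ ((U ⊓ U₁ : X.Opens) : Set X) from ⟨hxU, hxU₁⟩) (U ⊓ U₁).2
  have hAU : A ≤ U ⊓ U₁ := hAU
  let p : Γ(X, A) := resO (hAU.trans inf_le_right) p₁
  have hp : X.presheaf.germ A x hxA p = ϖ := by rw [germ_resO]; exact hp₁
  have hp0 : p ≠ 0 := by
    rintro h0
    rw [h0, map_zero] at hp
    exact hϖ.ne_zero hp.symm
  have : IsNoetherianRing Γ(X, A) := IsLocallyNoetherian.component_noetherian ⟨A, hA⟩
  have : NoetherianSpace (A : Set X) := noetherianSpace_of_isAffineOpen A hA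
  have hZ : IsClosed {y : A | y.1 ∉ X.basicOpen p} :=
    ((X.basicOpen p).isOpen.preimage continuous_subtype_val).isClosed_compl
  obtain ⟨S, hSf, hSc, hSi, hS⟩ :=
    NoetherianSpace.exists_finite_set_isClosed_irreducible (α := (A : Set X)) hZ
  -- remove the components of the zero locus that do not pass through `x`
  have hB : IsClosed (⋃₀ {T : Set A | T ∈ S ∧ (⟨x, hxA⟩ : A) ∉ T}) :=
    by
    rw [Set.sUnion_eq_biUnion]
    exact (hSf.subset (Set.sep_subset _ _)).isClosed_biUnion fun T hT => hSc T hT.1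
  let V : X.Opens := (Scheme.Opens.ι A) ''ᵁ
    ⟨(⋃₀ {T : Set A | T ∈ S ∧ (⟨x, hxA⟩ : A) ∉ T})ᶜ, hB.isOpen_compl⟩
  have hV : ∀ y, y ∈ V ↔ ∃ hy : y ∈ A, ∀ T ∈ S, (⟨y, hy⟩ : A) ∈ T → (⟨x, hxA⟩ : A) ∈ T := by
    intro y
    constructor
    · rintro ⟨z, hz, rfl⟩
      refine ⟨z.2, fun T hT hzT => ?_⟩
      by_contra hxT
      exact hz ⟨T, ⟨hT, hxT⟩, hzT⟩
    · rintro ⟨hy, H⟩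
      refine ⟨⟨y, hy⟩, ?_, rfl⟩
      rintro ⟨T, ⟨hT, hxT⟩, hyT⟩
      exact hxT (H T hT hyT)
  have hVA : V ≤ A := fun y hy => ((hV y).mp hy).1
  have hxV : x ∈ V := (hV x).mpr ⟨hxA, fun _ _ h => h⟩
  refine ⟨V, hxV, resO hVA p, hVA.trans (hAU.trans inf_le_left), ?_, ?_⟩
  · rw [germ_resO, hp]; exact hϖ
  · intro y hy hyx
    rw [germ_resO]
    by_contra hu
    have hyZ : (⟨y, hVA hy⟩ : A) ∈ {y : A | y.1 ∉ X.basicOpen p} := by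
      intro h
      exact hu ((X.mem_basicOpen p y (hVA hy)).mp h)
    rw [hS] at hyZ
    obtain ⟨T, hT, hyT⟩ := hyZ
    obtain ⟨_, H⟩ := (hV y).mp hy
    have hxT := H T hT hyT
    have : QuasiSober (A : Set X) := A.isOpenEmbedding.quasiSober
    obtain ⟨η, hη⟩ := QuasiSober.sober (α := (A : Set X)) (hSi T hT) (hSc T hT)
    have hηx : η.1 ⤳ x := (hη.specializes hxT).map continuous_subtype_val
    have hηy : η.1 ⤳ y := (hη.specializes hyT).map continuous_subtype_val
    rcases eq_or_eq_genericPoint_of_specializes hηx with h | h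
    · rw [h] at hηy
      exact hyx (Set.mem_singleton_iff.mp (hηy.mem_closed hx rfl))
    · have hηZ : η ∈ {y : A | y.1 ∉ X.basicOpen p} := by
        rw [hS]; exact ⟨T, hT, hη.mem⟩
      refine hηZ ?_
      have hgA : genericPoint X ∈ A := h ▸ η.2
      rw [h]
      exact (X.mem_basicOpen p _ hgA).mpr (isUnit_germ_genericPoint hgA hp0)

end Uniformizer

end

/-! ### Twists by effective divisors and their degrees -/

section Twist

variable {X : Scheme.{u}} (L : X.Modules) (D : X → ℕ)

lemma twistι_app_injective (U : X.Opens) : Function.Injective ((twistι L D).app U) :=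
  Subtype.val_injective

lemma twistι_app_vanishes {U : X.Opens} (s : Γ(twistDown L D, U)) {x : X} (hx : x ∈ U) :
    VanishesToOrder L ((twistι L D).app U s) x (D x) := s.2 x hx

lemma exists_twistι_app_eq {U : X.Opens} {t : Γ(L, U)}
    (ht : ∀ x ∈ U, VanishesToOrder L t x (D x)) : ∃ s, (twistι L D).app U s = t := ⟨⟨t, ht⟩, rfl⟩

variable {L D}

/-- A local equation `q` of the divisor `D` turns a frame `e` of `L` into the frame `q • e` of
`L(-D)`. -/
lemma exists_isFrame_twistDown {U V : X.Opens} {e : Γ(L, U)} (he : IsFrame L e) (h : V ≤ U)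
    (q : Γ(X, V)) (hq : ∀ (W : X.Opens) (hW : W ≤ V) (a : Γ(X, W)), a * resO hW q = 0 → a = 0)
    (hqD : ∀ (y : X) (hy : y ∈ V), Ideal.span {X.presheaf.germ V y hy q} =
      IsLocalRing.maximalIdeal (X.presheaf.stalk y) ^ D y) :
    ∃ e' : Γ(twistDown L D, V), IsFrame (twistDown L D) e' ∧
      (twistι L D).app V e' = q • res L h e := by
  obtain ⟨e', he'⟩ := exists_twistι_app_eq L D (t := q • res L h e) (fun y hy => by
    rw [vanishesToOrder_smul_frame_iff he h q hy, ← hqD y hy]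
    exact Ideal.mem_span_singleton_self _)
  have heq : ∀ (W : X.Opens) (hW : W ≤ V) (a : Γ(X, W)),
      (twistι L D).app W (a • res (twistDown L D) hW e') =
        (a * resO hW q) • res L (hW.trans h) e := by
    intro W hW a
    rw [Scheme.Modules.Hom.app_smul, app_res, he', res_smul, res_res, mul_smul]
  refine ⟨e', isFrame_of_locally ?_ ?_, he'⟩
  · intro W hW a ha
    refine hq W hW a ((he W (hW.trans h)).1 ?_)
    dsimp only
    rw [← heq, ha, map_zero, zero_smul]
  · intro W hW t y hy
    obtain ⟨a, ha⟩ := (he W (hW.trans h)).2 ((twistι L D).app W t)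
    dsimp only at ha
    have h1 := twistι_app_vanishes L D t hy
    rw [← ha, vanishesToOrder_smul_frame_iff he _ a hy, ← hqD y (hW hy),
      Ideal.mem_span_singleton] at h1
    -- the germ of `q` divides that of `a`; spread the quotient out to a neighbourhood of `y`
    obtain ⟨b, hb⟩ := h1
    obtain ⟨W₁, hW₁, hyW₁, b, rfl⟩ := TopCat.Presheaf.exists_le_germ_eq X.presheaf b hy
    have h2 : X.presheaf.germ W y hy a = X.presheaf.germ W₁ y hyW₁ (b * resO (hW₁.trans hW) q) := by
      rw [map_mul, germ_resO, hb, mul_comm]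
    obtain ⟨W₂, hyW₂, i, j, hij⟩ := TopCat.Presheaf.germ_eq X.presheaf y hy hyW₁ _ _ h2
    have hij : resO (leOfHom i) a = resO (leOfHom j) (b * resO (hW₁.trans hW) q) := hij
    refine ⟨W₂, leOfHom i, resO (leOfHom j) b, hyW₂, twistι_app_injective L D _ ?_⟩
    rw [heq, app_res, ← ha, res_smul, res_res]
    congr 1
    refine hij.trans ?_
    rw [resO, map_mul]
    congr 1
    exact resO_resO _ _ _

/-- A divisor that is supported at isolated closed points with discrete valuation local rings has a
local equation. -/
lemma exists_local_equation [IsIntegral X] [IsLocallyNoetherian X]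
    (hD : ∀ x, D x ≠ 0 → IsClosed {x} ∧ IsDiscreteValuationRing (X.presheaf.stalk x))
    (hfin : {x | D x ≠ 0}.Finite) {x : X} {U : X.Opens} (hxU : x ∈ U) :
    ∃ (V : X.Opens) (_ : V ≤ U) (q : Γ(X, V)), x ∈ V ∧ q ≠ 0 ∧
      (∀ (y : X) (hy : y ∈ V), Ideal.span {X.presheaf.germ V y hy q} =
        IsLocalRing.maximalIdeal (X.presheaf.stalk y) ^ D y) ∧
      ∀ hη : genericPoint X ∈ V,
        Scheme.ord (X.presheaf.germ V (genericPoint X) hη q) x = D x := by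
  -- shrink `U` so that `D` vanishes on it outside `x`
  have hcl : IsClosed ({y | D y ≠ 0} \ {x}) := by
    rw [← Set.biUnion_of_singleton ({y | D y ≠ 0} \ {x})]
    exact (hfin.subset Set.sdiff_subset).isClosed_biUnion fun y hy => (hD y hy.1).1
  let U' : X.Opens := U ⊓ ⟨({y | D y ≠ 0} \ {x})ᶜ, hcl.isOpen_compl⟩
  have hU' : ∀ y ∈ U', y ≠ x → D y = 0 := by
    intro y hy hyx
    by_contra h
    exact hy.2 ⟨h, hyx⟩
  have hxU' : x ∈ U' := ⟨hxU, fun h => h.2 rfl⟩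
  have hne : ∀ {V : X.Opens}, x ∈ V → Nonempty V := fun h => ⟨⟨_, h⟩⟩
  by_cases hx : D x = 0
  · have := hne hxU'
    refine ⟨U', inf_le_left, 1, hxU', one_ne_zero, fun y hy => ?_, fun hη => ?_⟩
    · have h0 : D y = 0 := by
        by_cases hyx : y = x
        · rw [hyx, hx]
        · exact hU' y hy hyx
      rw [h0, map_one, pow_zero, Ideal.span_singleton_one, Ideal.one_eq_top]
    · rw [hx]
      exact Scheme.ord_of_isUnit (U := U') isUnit_one hxU'
  · obtain ⟨hxc, hdvr⟩ := hD x hx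
    obtain ⟨V, hxV, p, hVU, hp, hpu⟩ := exists_uniformizer hxc hxU'
    have := hne hxV
    have hp0 : p ≠ 0 := by
      rintro rfl
      rw [map_zero] at hp
      exact hp.ne_zero rfl
    refine ⟨V, hVU.trans inf_le_left, p ^ D x, hxV, pow_ne_zero _ hp0, fun y hy => ?_, fun hη => ?_⟩
    · rw [map_pow, ← Ideal.span_singleton_pow]
      by_cases hyx : y = x
      · subst hyx
        rw [hp.maximalIdeal_eq]
      · rw [hU' y (hVU hy) hyx, pow_zero, Ideal.span_singleton_eq_top.mpr (hpu y hy hyx),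
          ← Ideal.one_eq_top, one_pow]
    · have hco : Order.coheight x = 1 := by
        have := ringKrullDim_stalk_eq_coheight x
        rw [IsDiscreteValuationRing.ringKrullDim_eq_one] at this
        exact_mod_cast this.symm
      have hpη : (X.presheaf.germ V (genericPoint X) hη p : X.functionField) ≠ 0 :=
        (isUnit_germ_genericPoint hη hp0).ne_zero
      rw [map_pow, Scheme.ord_eq_iff hco (pow_ne_zero _ hpη), map_pow]
      have h1 : Scheme.ordHom x hco (X.presheaf.germ V (genericPoint X) hη p) = WithZero.exp 1 := by
        have h2 := Scheme.algebraMap_germ_eq_germToFunctionField X hxV p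
        have : Ring.KrullDimLE 1 (X.presheaf.stalk x) := krullDimLE_of_coheight_le hco.le
        refine Eq.trans (congrArg _ h2.symm) ?_
        exact Ring.ordFrac_irreducible hp
      rw [h1, ← WithZero.exp_nsmul, nsmul_one]
      rfl

lemma mul_resO_eq_zero [IsIntegral X] {V : X.Opens} {q : Γ(X, V)} (hq : q ≠ 0) (W : X.Opens)
    (hW : W ≤ V) (a : Γ(X, W)) (ha : a * resO hW q = 0) : a = 0 := by
  by_cases hne : Nonempty W
  · refine (mul_eq_zero.mp ha).resolve_right fun h => hq ?_
    exact (map_injective_of_isIntegral X (homOfLE hW)) (h.trans (map_zero _).symm)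
  · have : W = ⊥ := eq_bot_iff.mpr fun y hy => (hne ⟨⟨y, hy⟩⟩).elim
    have := subsingleton_fun_of_eq_bot this
    exact Subsingleton.elim _ _

lemma IsLineBundle.twistDown [IsIntegral X] [IsLocallyNoetherian X] (hL : IsLineBundle L)
    (hD : ∀ x, D x ≠ 0 → IsClosed {x} ∧ IsDiscreteValuationRing (X.presheaf.stalk x))
    (hfin : {x | D x ≠ 0}.Finite) : IsLineBundle (twistDown L D) := by
  intro x
  obtain ⟨U, e, hxU, he⟩ := hL x
  obtain ⟨V, hVU, q, hxV, hq0, hqD, -⟩ := exists_local_equation hD hfin hxU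
  obtain ⟨e', he', -⟩ := exists_isFrame_twistDown he hVU q (mul_resO_eq_zero hq0) hqD
  exact ⟨V, e', hxV, he'⟩

lemma not_isDiscreteValuationRing_stalk_genericPoint [IsIntegral X] :
    ¬ IsDiscreteValuationRing (X.presheaf.stalk (genericPoint X)) := fun _ =>
  IsDiscreteValuationRing.not_isField (X.presheaf.stalk (genericPoint X))
    (Field.toIsField X.functionField)

/-- Twisting by `-D` lowers the degree by the degree of `D`: a rational section `s = b • e` of `L`
is `(b / q) • (q • e)` in `L(-D)`, where `q` is a local equation of `D`. -/
lemma HasDegree.twistDown [IsIntegral X] [IsLocallyNoetherian X] {n : ℤ} (hL : HasDegree L n)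
    (hD : ∀ x, D x ≠ 0 → IsClosed {x} ∧ IsDiscreteValuationRing (X.presheaf.stalk x))
    (hfin : {x | D x ≠ 0}.Finite) :
    HasDegree (twistDown L D) (n - ∑ x ∈ hfin.toFinset, (D x : ℤ)) := by
  obtain ⟨U, s, E, hη, hs, hE, hsum⟩ := hL
  have hcl : IsClosed {y | D y ≠ 0} := by
    rw [← Set.biUnion_of_singleton {y | D y ≠ 0}]
    exact hfin.isClosed_biUnion fun y hy => (hD y hy).1
  -- remove the support of `D`, where the rational section need not lie in `L(-D)`
  let U' : X.Opens := U ⊓ ⟨{y | D y ≠ 0}ᶜ, hcl.isOpen_compl⟩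
  have hU'U : U' ≤ U := inf_le_left
  have hηU' : genericPoint X ∈ U' :=
    ⟨hη, fun h => not_isDiscreteValuationRing_stalk_genericPoint (hD _ h).2⟩
  obtain ⟨s', hs'⟩ := exists_twistι_app_eq L D (t := res L hU'U s) (by
    intro x hx
    have : D x = 0 := not_not.mp hx.2
    rw [this]
    exact ⟨U', le_rfl, hx, by simp⟩)
  -- restrictions of the coefficient of `s` to non-empty open sets do not vanish
  have hres : ∀ {W W' : X.Opens} (h : W' ≤ W) {b : Γ(X, W)}, genericPoint X ∈ W' → b ≠ 0 →
      resO h b ≠ 0 := by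
    intro W W' h b hηW hb h0
    have : Nonempty W' := ⟨⟨_, hηW⟩⟩
    exact hb (map_injective_of_isIntegral X (homOfLE h) (h0.trans (map_zero _).symm))
  refine ⟨U', s', E - Finsupp.onFinset hfin.toFinset (fun x => (D x : ℤ)) (by simp), hηU', ?_, ?_,
    ?_⟩
  · rintro rfl
    obtain ⟨V, e, W, hU, hV, hηW, b, -, he, hb, hb0, -⟩ := hE (genericPoint X)
    refine hres (inf_le_left : W ⊓ U' ≤ W) ⟨hηW, hηU'⟩ hb0
      ((he (W ⊓ U') (inf_le_left.trans hV)).1 ?_)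
    have h1 := congrArg (res L (inf_le_left : W ⊓ U' ≤ W)) hb
    have h2 := congrArg (res L (inf_le_right : W ⊓ U' ≤ U')) hs'
    rw [res_res, res_smul, res_res] at h1
    rw [map_zero, res_zero, res_res] at h2
    dsimp only
    rw [zero_smul, h2]
    exact h1.symm
  · intro x
    obtain ⟨V, e, W, hU, hV, hηW, b, hxV, he, hb, hb0, hord⟩ := hE x
    obtain ⟨V₁, hV₁, q, hxV₁, hq0, hqD, hqord⟩ := exists_local_equation hD hfin hxV
    obtain ⟨e', he', hee'⟩ := exists_isFrame_twistDown he hV₁ q (mul_resO_eq_zero hq0) hqD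
    have hηV₁ : genericPoint X ∈ V₁ :=
      ((genericPoint_spec X).mem_open_set_iff V₁.isOpen).mpr ⟨x, trivial, hxV₁⟩
    let W' : X.Opens := W ⊓ U' ⊓ X.basicOpen q
    have h1 : W' ≤ W := inf_le_left.trans inf_le_left
    have h2 : W' ≤ U' := inf_le_left.trans inf_le_right
    have h3 : W' ≤ V₁ := inf_le_right.trans (X.basicOpen_le q)
    have hηW' : genericPoint X ∈ W' :=
      ⟨⟨hηW, hηU'⟩, (X.mem_basicOpen q _ hηV₁).mpr (isUnit_germ_genericPoint hηV₁ hq0)⟩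
    have hu : IsUnit (resO h3 q) := by
      rw [← resO_resO (X.basicOpen_le q) inf_le_right]
      exact (RingedSpace.isUnit_res_basicOpen _ q).map (X.presheaf.map _).hom
    obtain ⟨u, hu⟩ := hu
    have hbu : (resO h1 b * ↑u⁻¹) * resO h3 q = resO h1 b := by
      rw [← hu, mul_assoc, Units.inv_mul, mul_one]
    refine ⟨V₁, e', W', h2, h3, hηW', resO h1 b * ↑u⁻¹, hxV₁, he', ?_, ?_, ?_⟩
    · apply twistι_app_injective
      rw [Scheme.Modules.Hom.app_smul, app_res, app_res, hs', hee', res_smul, res_res, res_res,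
        ← mul_smul, hbu]
      have := congrArg (res L h1) hb
      rwa [res_res, res_smul, res_res] at this
    · intro h0
      rw [h0, zero_mul] at hbu
      exact hres h1 hηW' hb0 hbu.symm
    · have hb'0 : resO h1 b * ↑u⁻¹ ≠ 0 := by
        intro h0
        rw [h0, zero_mul] at hbu
        exact hres h1 hηW' hb0 hbu.symm
      have h4 := congrArg (X.presheaf.germ W' (genericPoint X) hηW') hbu
      rw [map_mul, germ_resO, germ_resO] at h4
      have h5 := Scheme.ord_mul (X := X) (x := x)
        (isUnit_germ_genericPoint hηW' hb'0).ne_zero (isUnit_germ_genericPoint hηV₁ hq0).ne_zero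
      have h6 := hqord hηV₁
      have h7 := congrArg (fun f : X.functionField => Scheme.ord f x) h4
      dsimp only at h7
      rw [hord] at h7
      simp only [Finsupp.coe_sub, Pi.sub_apply, Finsupp.onFinset_apply]
      rw [← h6, ← h7]
      exact eq_sub_of_add_eq h5.symm
  · rw [Finsupp.sum_sub_index (fun _ _ _ => rfl), hsum, Finsupp.onFinset_sum _ (fun _ => rfl)]

lemma HasDegree.of_iso [IsIntegral X] [IsLocallyNoetherian X] {N : X.Modules} (φ : L ≅ N) {n : ℤ}
    (h : HasDegree L n) : HasDegree N n := by
  have hinj : ∀ U, Function.Injective (φ.hom.app U) := fun U =>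
    (ConcreteCategory.bijective_of_isIso (φ.hom.app U)).1
  obtain ⟨U, s, E, hη, hs, hE, hsum⟩ := h
  refine ⟨U, φ.hom.app U s, E, hη, ?_, fun x => ?_, hsum⟩
  · exact fun h0 => hs (hinj U (h0.trans (map_zero _).symm))
  · obtain ⟨V, e, W, hU, hV, hηW, b, hxV, he, hb, hb0, hord⟩ := hE x
    refine ⟨V, φ.hom.app V e, W, hU, hV, hηW, b, hxV, he.map_of_isIso φ.hom, ?_, hb0, hord⟩
    rw [← app_res, ← app_res, hb, Scheme.Modules.Hom.app_smul]

end Twist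

/-! ### The dual graph and the direction of a node -/

section Trees

variable {V : Type*} {G : SimpleGraph V} {i j l : V}

/-- The neighbour `l` of the vertex `j` lies in the direction of `i`: it can be joined to `i`
without passing through `j`. -/
def LeadsTo (G : SimpleGraph V) (i j l : V) : Prop :=
  G.Adj j l ∧ ∃ p : G.Walk l i, j ∉ p.support

lemma LeadsTo.exists_path (h : LeadsTo G i j l) :
    ∃ p : G.Walk j i, p.IsPath ∧ p.snd = l := by
  classical
  obtain ⟨hadj, p, hp⟩ := h
  refine ⟨.cons hadj p.bypass, (p.bypass_isPath).cons fun h =>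
    hp (p.support_bypass_subset_support h), ?_⟩
  simp

lemma exists_leadsTo (hG : G.Connected) (hij : j ≠ i) : ∃ l, LeadsTo G i j l := by
  classical
  obtain ⟨p⟩ := hG.preconnected j i
  have hp := p.bypass_isPath
  revert hp
  generalize p.bypass = q
  intro hq
  cases q with
  | nil => exact (hij rfl).elim
  | cons h q => exact ⟨_, h, q, ((SimpleGraph.Walk.cons_isPath_iff _ _).mp hq).2⟩

lemma LeadsTo.unique (hG : G.IsAcyclic) {l' : V} (h : LeadsTo G i j l) (h' : LeadsTo G i j l') :
    l = l' := by
  obtain ⟨p, hp, rfl⟩ := h.exists_path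
  obtain ⟨q, hq, rfl⟩ := h'.exists_path
  have := (hG.subsingleton_path _ _).elim ⟨p, hp⟩ ⟨q, hq⟩
  rw [Subtype.mk.injEq] at this
  rw [this]

lemma LeadsTo.asymm (hG : G.IsAcyclic) (h : LeadsTo G i j l) : ¬ LeadsTo G i l j := by
  classical
  rintro ⟨-, q, hq⟩
  obtain ⟨p, hp, rfl⟩ := h.exists_path
  have := (hG.subsingleton_path _ _).elim ⟨p, hp⟩ ⟨q.bypass, q.bypass_isPath⟩
  rw [Subtype.mk.injEq] at this
  refine hq (q.support_bypass_subset_support ?_)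
  rw [← this]
  exact p.getVert_mem_support 1

lemma leadsTo_or_leadsTo (hG : G.Connected) (h : G.Adj j l) :
    LeadsTo G i j l ∨ LeadsTo G i l j := by
  classical
  obtain ⟨p⟩ := hG.preconnected l i
  by_cases hj : j ∈ p.bypass.support
  · refine .inr ⟨h.symm, p.bypass.dropUntil j hj, fun hl => ?_⟩
    have hnd := p.bypass_isPath.support_nodup
    rw [← p.bypass.take_spec hj, SimpleGraph.Walk.support_append] at hnd
    rw [← SimpleGraph.Walk.cons_tail_support, List.mem_cons] at hl
    exact List.disjoint_of_nodup_append hnd (SimpleGraph.Walk.start_mem_support _)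
      (hl.resolve_left h.ne.symm)
  · exact .inl ⟨h, p.bypass, hj⟩

end Trees

namespace CompactTypeCurve

variable {k : Type u} [Field k] (Y : CompactTypeCurve k)

/-- The dual graph of the curve: its vertices are the components, its edges are the nodes. -/
abbrev dualGraph : SimpleGraph Y.Idx :=
  SimpleGraph.fromRel fun j l => (Set.range (Y.ι j) ∩ Set.range (Y.ι l)).Nonempty

variable {Y}

lemma dualGraph_adj {j l : Y.Idx} :
    Y.dualGraph.Adj j l ↔ j ≠ l ∧ (Set.range (Y.ι j) ∩ Set.range (Y.ι l)).Nonempty := by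
  rw [SimpleGraph.fromRel_adj, Set.inter_comm (Set.range (Y.ι l)), or_self]

lemma isClosed_range (j : Y.Idx) : IsClosed (Set.range (Y.ι j)) :=
  (Y.ι j).isClosedEmbedding.isClosed_range

lemma range_mem_irreducibleComponents (j : Y.Idx) :
    Set.range (Y.ι j) ∈ irreducibleComponents Y.C := Y.range_eq ▸ ⟨j, rfl⟩

lemma exists_mem_range (x : Y.C) : ∃ j, x ∈ Set.range (Y.ι j) := by
  have h : x ∈ ⋃₀ irreducibleComponents Y.C := by rw [sUnion_irreducibleComponents]; trivial
  rw [← Y.range_eq] at h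
  obtain ⟨_, ⟨j, rfl⟩, hj⟩ := h
  exact ⟨j, hj⟩

/-- A component contained in a union of components is one of them. -/
lemma mem_of_range_subset {A : Set Y.Idx} {i : Y.Idx}
    (h : Set.range (Y.ι i) ⊆ ⋃ m ∈ A, Set.range (Y.ι m)) : i ∈ A := by
  have hi := range_mem_irreducibleComponents i
  obtain ⟨t, ht, hit⟩ := isIrreducible_iff_sUnion_isClosed.mp hi.1
    (((Set.toFinite A).image fun m => Set.range (Y.ι m)).toFinset)
    (fun t ht => by
      obtain ⟨m, -, rfl⟩ := (Set.Finite.mem_toFinset _).mp ht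
      exact isClosed_range m)
    (by simpa using h)
  obtain ⟨m, hm, rfl⟩ := (Set.Finite.mem_toFinset _).mp ht
  have : i = m := Y.range_injective (hit.antisymm
    (hi.2 (range_mem_irreducibleComponents m).1 hit))
  exact this ▸ hm

lemma isPreconnected_range_sdiff (j m : Y.Idx) :
    _root_.IsPreconnected (Set.range (Y.ι m) \ Set.range (Y.ι j)) := by
  refine IsPreirreducible.isPreconnected fun u v hu hv ⟨x, hx, hxu⟩ ⟨y, hy, hyv⟩ => ?_
  have hO := (isClosed_range (Y := Y) j).isOpen_compl
  obtain ⟨z, hz, hzu, hzv⟩ := (range_mem_irreducibleComponents m).1.2 _ _ (hu.inter hO)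
    (hv.inter hO) ⟨x, hx.1, hxu, hx.2⟩ ⟨y, hy.1, hyv, hy.2⟩
  exact ⟨z, ⟨hz, hzu.2⟩, hzu.1, hzv.1⟩

/-- The part of a component outside another one is dense in it. -/
lemma range_subset_closure_sdiff {j m : Y.Idx} (h : m ≠ j) :
    Set.range (Y.ι m) ⊆ closure (Set.range (Y.ι m) \ Set.range (Y.ι j)) := by
  rw [Set.sdiff_eq]
  refine subset_closure_inter_of_isPreirreducible_of_isOpen
    (range_mem_irreducibleComponents m).1.isPreirreducible (isClosed_range j).isOpen_compl ?_
  by_contra h0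
  have h1 : Set.range (Y.ι m) ⊆ ⋃ n ∈ ({j} : Set Y.Idx), Set.range (Y.ι n) := by
    intro x hx
    by_contra hxj
    exact h0 ⟨x, hx, fun hj => hxj (by simpa using hj)⟩
  exact h (mem_of_range_subset (A := {j}) h1)

/-- The node in which `C_j` meets `C_l` is the one towards `C_i` iff `l` leads from `j` to `i` in
the dual graph. -/
lemma isToward_iff {i j l : Y.Idx} (hl : l ≠ j) {x : Y.comp j} (hx : Y.ι j x ∈ Set.range (Y.ι l)) :
    Y.IsToward i j x ↔ LeadsTo Y.dualGraph i j l := by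
  have hadj : Y.dualGraph.Adj j l := dualGraph_adj.mpr ⟨hl.symm, _, ⟨x, rfl⟩, hx⟩
  constructor
  · rintro ⟨y, hy, hi, hxy⟩
    have hDpre : _root_.IsPreconnected (connectedComponentIn (Set.range (Y.ι j))ᶜ y) :=
      isPreconnected_connectedComponentIn
    have hDsub := connectedComponentIn_subset (Set.range (Y.ι j))ᶜ y
    revert hDpre hDsub hi hxy
    generalize connectedComponentIn (Set.range (Y.ι j))ᶜ y = D
    intro hi hxy hDpre hDsub
    -- the components that can be joined to `C_i` in the complement of `C_j`, and the others
    let A : Set Y.Idx := {m | ∃ p : Y.dualGraph.Walk m i, j ∉ p.support}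
    let B : Set Y.Idx := {m | m ≠ j ∧ m ∉ A}
    let Z : Set Y.Idx → Set Y.C := fun S => ⋃ m ∈ S, Set.range (Y.ι m)
    have hZ : ∀ S, IsClosed (Z S) := fun S =>
      (Set.toFinite S).isClosed_biUnion fun m _ => isClosed_range m
    have hDZ : D ⊆ Z A ∪ Z B := by
      intro z hz
      obtain ⟨m, hm⟩ := exists_mem_range z
      have hmj : m ≠ j := by rintro rfl; exact hDsub hz hm
      by_cases hmA : m ∈ A
      · exact .inl (Set.mem_biUnion hmA hm)
      · exact .inr (Set.mem_biUnion (show m ∈ B from ⟨hmj, hmA⟩) hm)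
    -- a component outside `A` that meets one in `A` could itself be joined to `C_i`
    have hAB : D ∩ (Z A ∩ Z B) = ∅ := by
      rw [Set.eq_empty_iff_forall_notMem]
      rintro z ⟨-, hzA, hzB⟩
      obtain ⟨m, ⟨p, hp⟩, hzm⟩ := Set.mem_iUnion₂.mp hzA
      obtain ⟨m', ⟨hm'j, hm'A⟩, hzm'⟩ := Set.mem_iUnion₂.mp hzB
      have hmm' : m' ≠ m := by rintro rfl; exact hm'A ⟨p, hp⟩
      refine hm'A ⟨.cons (dualGraph_adj.mpr ⟨hmm', z, hzm', hzm⟩) p, ?_⟩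
      rw [SimpleGraph.Walk.support_cons, List.mem_cons, not_or]
      exact ⟨hm'j.symm, hp⟩
    have hsub := isPreconnected_iff_subset_of_disjoint_closed.mp hDpre (Z A) (Z B) (hZ A) (hZ B)
      hDZ hAB
    have hDA : D ⊆ Z A := by
      refine hsub.resolve_right fun hDB => ?_
      have hiB := mem_of_range_subset (hi.trans ((hZ B).closure_subset_iff.mpr hDB))
      exact hiB.2 ⟨.nil, by simpa using hiB.1.symm⟩
    obtain ⟨m, hmA, hxm⟩ := Set.mem_iUnion₂.mp ((hZ A).closure_subset_iff.mpr hDA hxy)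
    obtain ⟨p, hp⟩ := hmA
    have hmj : m ≠ j := by rintro rfl; exact hp p.start_mem_support
    obtain h | h | rfl := Y.two_branches _ j l m ⟨x, rfl⟩ hx hxm
    · exact (hl h.symm).elim
    · exact (hmj h.symm).elim
    · exact ⟨hadj, p, hp⟩
  · rintro ⟨-, p, hp⟩
    have hij : i ≠ j := by rintro rfl; exact hp p.end_mem_support
    have hne : ∀ m ≠ j, (Set.range (Y.ι m) \ Set.range (Y.ι j)).Nonempty := fun m hm =>
      closure_nonempty_iff.mp ((range_mem_irreducibleComponents m).1.nonempty.mono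
        (range_subset_closure_sdiff hm))
    obtain ⟨y, hyi, hyj⟩ := hne i hij
    -- along a walk that avoids `j`, consecutive components meet outside `C_j`
    have key : ∀ {m n : Y.Idx} (p : Y.dualGraph.Walk m n), j ∉ p.support →
        ∀ y ∈ Set.range (Y.ι n) \ Set.range (Y.ι j),
        Set.range (Y.ι m) \ Set.range (Y.ι j) ⊆ connectedComponentIn (Set.range (Y.ι j))ᶜ y := by
      intro m n p
      induction p with
      | nil =>
        intro _ y hy
        exact (isPreconnected_range_sdiff _ _).subset_connectedComponentIn hy fun _ h => h.2
      | @cons m m' n h p ih =>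
        intro hj y hy
        rw [SimpleGraph.Walk.support_cons, List.mem_cons, not_or] at hj
        obtain ⟨hmm', z, hzm, hzm'⟩ := dualGraph_adj.mp h
        have hm'j : m' ≠ j := by rintro rfl; exact hj.2 p.start_mem_support
        have hzj : z ∉ Set.range (Y.ι j) := by
          intro hzj
          obtain h | h | h := Y.two_branches z j m m' hzj hzm hzm'
          exacts [hj.1 h, hm'j h.symm, hmm' h]
        have hz := ih hj.2 y hy ⟨hzm', hzj⟩
        rw [connectedComponentIn_eq hz]
        exact (isPreconnected_range_sdiff _ _).subset_connectedComponentIn ⟨hzm, hzj⟩ fun _ h => h.2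
    refine ⟨y, hyj, ?_, ?_⟩
    · exact (range_subset_closure_sdiff hij).trans
        (closure_mono (key .nil (by simpa using hij.symm) y ⟨hyi, hyj⟩))
    · exact (range_subset_closure_sdiff hl).trans (closure_mono (key p hp y ⟨hyi, hyj⟩)) hx

end CompactTypeCurve

section Trees

variable {V : Type*} {G : SimpleGraph V} {i : V}

open Classical in
/-- In a tree rooted at `i`, every vertex `j ≠ i` has one edge leading to `i`, and every edge leads
to `i` from exactly one of its ends. -/
lemma sum_sum_eq_of_leadsTo [Fintype V] (hG : G.IsTree) (w : V → V → ℤ) (d : ℤ)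
    (h0 : ∀ j l, ¬ G.Adj j l → w j l = 0) (hd : ∀ j l, LeadsTo G i j l → w j l + w l j = d) :
    ∑ j, ∑ l, w j l = (Fintype.card V - 1) * d := by
  have h1 : ∀ j l, w j l = (if LeadsTo G i j l then w j l else 0) +
      (if LeadsTo G i l j then w j l else 0) := by
    intro j l
    by_cases hadj : G.Adj j l
    · rcases leadsTo_or_leadsTo (i := i) hG.connected hadj with h | h
      · rw [if_pos h, if_neg (h.asymm hG.isAcyclic), add_zero]
      · rw [if_pos h, if_neg (h.asymm hG.isAcyclic), zero_add]
    · rw [h0 j l hadj, ite_self, ite_self, add_zero]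
  have h2 : ∑ j, ∑ l, w j l = ∑ j, ∑ l, if LeadsTo G i j l then d else 0 := by
    calc ∑ j, ∑ l, w j l
        = ∑ j, ∑ l, (if LeadsTo G i j l then w j l else 0) +
            ∑ j, ∑ l, (if LeadsTo G i l j then w j l else 0) := by
          rw [← Finset.sum_add_distrib]
          refine Finset.sum_congr rfl fun j _ => ?_
          rw [← Finset.sum_add_distrib]
          exact Finset.sum_congr rfl fun l _ => h1 j l
      _ = ∑ j, ∑ l, (if LeadsTo G i j l then w j l else 0) +
            ∑ j, ∑ l, (if LeadsTo G i j l then w l j else 0) := by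
          rw [Finset.sum_comm (f := fun j l => if LeadsTo G i l j then w j l else 0)]
      _ = _ := by
          rw [← Finset.sum_add_distrib]
          refine Finset.sum_congr rfl fun j _ => ?_
          rw [← Finset.sum_add_distrib]
          refine Finset.sum_congr rfl fun l _ => ?_
          split_ifs with h
          · exact hd j l h
          · rfl
  have h3 : ∀ j, (∑ l, if LeadsTo G i j l then d else 0) = if j = i then 0 else d := by
    intro j
    split_ifs with hj
    · subst hj
      exact Finset.sum_eq_zero fun l _ => if_neg fun ⟨_, p, hp⟩ => hp p.end_mem_support
    · obtain ⟨l, hl⟩ := exists_leadsTo hG.connected hj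
      rw [Finset.sum_eq_single l (fun l' _ hl' => if_neg fun h => hl' (h.unique hG.isAcyclic hl))
        (by simp), if_pos hl]
  rw [h2, Finset.sum_congr rfl fun j _ => h3 j, Finset.sum_ite, Finset.sum_const_zero, zero_add,
    Finset.sum_const, Finset.filter_ne', Finset.card_erase_of_mem (Finset.mem_univ i),
    Finset.card_univ, nsmul_eq_mul, Nat.cast_sub (Fintype.card_pos_iff.mpr ⟨i⟩), Nat.cast_one]

end Trees

/-! ### Limit linear series -/

section Sections

lemma VanishesToOrder.mono {X : Scheme.{u}} {L : X.Modules} {U : X.Opens} {s : Γ(L, U)} {x : X}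
    {m n : ℕ} (hmn : m ≤ n) (h : VanishesToOrder L s x n) : VanishesToOrder L s x m := by
  obtain ⟨V, hV, hx, H⟩ := h
  exact ⟨V, hV, hx, Submodule.smul_mono_left (Ideal.comap_mono (Ideal.pow_le_pow_right hmn)) H⟩

lemma vanishesToOrder_zero {X : Scheme.{u}} {L : X.Modules} {U : X.Opens} (s : Γ(L, U)) {x : X}
    (hx : x ∈ U) : VanishesToOrder L s x 0 :=
  ⟨U, le_rfl, hx, by simp⟩

lemma zero_vanishesToOrder {X : Scheme.{u}} {L : X.Modules} {U : X.Opens} {x : X}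
    (hx : x ∈ U) (n : ℕ) : VanishesToOrder L (0 : Γ(L, U)) x n :=
  ⟨U, le_rfl, hx, by rw [res_zero]; exact zero_mem _⟩

variable {k : Type u} [Field k] {X : Scheme.{u}} (f : X ⟶ Spec (.of k)) {L N : X.Modules}

/-- The map on global sections induced by a homomorphism of modules, as a linear map. -/
noncomputable def sectionsLinearMap (φ : L ⟶ N) : GlobalSections f L →ₗ[k] GlobalSections f N where
  toFun := sectionsMap f φ
  map_add' s t := map_add (φ.app ⊤).hom s t
  map_smul' a s := Scheme.Modules.Hom.app_smul φ (scalars f a) (show Γ(L, ⊤) from s)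

variable {f} (V : Submodule k (GlobalSections f L)) (x : X) (r : ℕ)

/-- `u_r` is the least order of vanishing. -/
lemma vanishesToOrder_vanishingOrder_self {s : GlobalSections f L} (hs : s ∈ V) :
    VanishesToOrder L (U := ⊤) s x (vanishingOrder f V x r r) := by
  classical
  by_contra h
  have hex : ∃ n, ¬ VanishesToOrder L (U := ⊤) s x n := ⟨_, h⟩
  have hle := Nat.find_min' hex h
  -- `s` has order exactly `n`, one less than the first order to which it does not vanish
  obtain ⟨n, hn⟩ : ∃ n, Nat.find hex = n + 1 := Nat.exists_eq_succ_of_ne_zero fun h0 => by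
    have := Nat.find_spec hex
    rw [h0] at this
    exact this (vanishesToOrder_zero (L := L) (U := ⊤) s trivial)
  have hmem : n ∈ vanishingOrders f V x := by
    refine ⟨s, hs, not_not.mp (Nat.find_min hex (by omega)), ?_⟩
    rw [← hn]; exact Nat.find_spec hex
  have : vanishingOrder f V x r r ≤ n := by
    rw [vanishingOrder, Nat.sub_self, Nat.nth_zero]
    exact Nat.sInf_le hmem
  omega

/-- Some nonzero section vanishes to order `u_0`. If there were not enough orders of vanishing for
`u_0` to be defined, then its value would be `0`, and every nonzero section would do. -/
lemma exists_vanishesToOrder_vanishingOrder_zero (hV : Module.finrank k V = r + 1) :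
    ∃ s ∈ V, s ≠ 0 ∧ VanishesToOrder L (U := ⊤) s x (vanishingOrder f V x r 0) := by
  by_cases h : ∀ hf : (Set.ofPred fun n => n ∈ vanishingOrders f V x).Finite, r < hf.toFinset.card
  · obtain ⟨s, hs, hs1, hs2⟩ := Nat.nth_mem r h
    refine ⟨s, hs, ?_, hs1⟩
    rintro rfl
    exact hs2 (zero_vanishesToOrder (L := L) (U := ⊤) trivial _)
  · push Not at h
    obtain ⟨hf, hr⟩ := h
    have : Nontrivial V := Module.nontrivial_of_finrank_pos (R := k) (by omega)
    obtain ⟨s, hs⟩ := exists_ne (0 : V)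
    refine ⟨s, s.2, fun h => hs (Subtype.ext h), ?_⟩
    rw [vanishingOrder, Nat.sub_zero, Nat.nth_of_card_le hf hr]
    exact vanishesToOrder_zero (L := L) (U := ⊤) _ trivial

end Sections

namespace CompactTypeCurve

variable {k : Type u} [Field k] {Y : CompactTypeCurve k}

lemma eq_of_mem_range {j l : Y.Idx} (h : l ≠ j) {x x' : Y.comp j}
    (hx : Y.ι j x ∈ Set.range (Y.ι l)) (hx' : Y.ι j x' ∈ Set.range (Y.ι l)) : x = x' :=
  (Y.ι j).isClosedEmbedding.injective (Y.meet_once j l h.symm ⟨⟨x, rfl⟩, hx⟩ ⟨⟨x', rfl⟩, hx'⟩)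

lemma IsNode.isClosed {j : Y.Idx} {x : Y.comp j} (h : Y.IsNode j x) : IsClosed {x} := by
  obtain ⟨l, hl, hx⟩ := h
  have : {x} = Y.ι j ⁻¹' Set.range (Y.ι l) := by
    ext x'
    exact ⟨fun h => by rw [Set.mem_singleton_iff.mp h]; exact hx, fun h => eq_of_mem_range hl h hx⟩
  rw [this]
  exact (isClosed_range l).preimage (Y.ι j).continuous

lemma finite_setOf_isNode (j : Y.Idx) : {x | Y.IsNode j x}.Finite := by
  have : {x | Y.IsNode j x} ⊆ ⋃ l ∈ {l | l ≠ j}, Y.ι j ⁻¹' Set.range (Y.ι l) := by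
    rintro x ⟨l, hl, hx⟩
    exact Set.mem_biUnion (show l ∈ {l | l ≠ j} from hl) hx
  refine Set.Finite.subset ((Set.toFinite _).biUnion fun l hl => ?_) this
  exact Set.Subsingleton.finite fun x hx x' hx' => eq_of_mem_range hl hx hx'

/-- Every point has a neighbourhood that contains no node except possibly itself. -/
lemma exists_open_one_component (x : Y.C) : ∃ W : Y.C.Opens, x ∈ W ∧
    ∀ y ∈ W, y ≠ x → ∃ j, ∀ l ≠ j, y ∉ Set.range (Y.ι l) := by
  let T : Set (Y.Idx × Y.Idx) :=
    {p | p.1 ≠ p.2 ∧ x ∉ Set.range (Y.ι p.1) ∩ Set.range (Y.ι p.2)}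
  have hT : IsClosed (⋃ p ∈ T, Set.range (Y.ι p.1) ∩ Set.range (Y.ι p.2)) :=
    (Set.toFinite T).isClosed_biUnion fun p _ => (isClosed_range _).inter (isClosed_range _)
  refine ⟨⟨_, hT.isOpen_compl⟩, fun h => ?_, fun y hy hyx => ?_⟩
  · obtain ⟨p, hp, hxp⟩ := Set.mem_iUnion₂.mp h
    exact hp.2 hxp
  · obtain ⟨j, hj⟩ := exists_mem_range y
    refine ⟨j, fun l hl hyl => hy (Set.mem_biUnion (show (l, j) ∈ T from ⟨hl, fun hx => hyx ?_⟩)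
      ⟨hyl, hj⟩)⟩
    exact Y.meet_once l j hl ⟨hyl, hj⟩ hx

end CompactTypeCurve

namespace LimitLinearSeries

variable {k : Type u} [Field k] {Y : CompactTypeCurve k} {d r : ℕ} (S : LimitLinearSeries Y d r)
  (i j : Y.Idx)

lemma isNode_of_twistDivisor_ne_zero {x : Y.comp j} (h : S.twistDivisor i j x ≠ 0) :
    Y.IsNode j x := by
  by_contra h0
  exact h (if_neg h0)

lemma twistDivisor_isolated (x : Y.comp j) (h : S.twistDivisor i j x ≠ 0) :
    IsClosed {x} ∧ IsDiscreteValuationRing ((Y.comp j).presheaf.stalk x) := by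
  have hx := (S.isNode_of_twistDivisor_ne_zero i j h).isClosed
  exact ⟨hx, Y.nonsingular j x hx⟩

lemma finite_support_twistDivisor : {x | S.twistDivisor i j x ≠ 0}.Finite :=
  (CompactTypeCurve.finite_setOf_isNode j).subset fun _ h =>
    S.isNode_of_twistDivisor_ne_zero i j h

lemma isLineBundle_twist : IsLineBundle (S.twist i j) :=
  (S.isLineBundle j).twistDown (S.twistDivisor_isolated i j) (S.finite_support_twistDivisor i j)

lemma exists_isGluing : ∃ N : Y.C.Modules, S.IsGluing i N :=
  exists_glued_lineBundle Y.ι CompactTypeCurve.exists_mem_range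
    (fun j => S.isLineBundle_twist i j) CompactTypeCurve.exists_open_one_component

open Classical in
/-- The value of the twisting divisor at the node where `C_j` meets `C_l`. -/
lemma twistDivisor_eq {l : Y.Idx} (hl : l ≠ j) {x : Y.comp j}
    (hx : Y.ι j x ∈ Set.range (Y.ι l)) :
    S.twistDivisor i j x = if LeadsTo Y.dualGraph i j l then S.u j x 0 else S.u j x r := by
  rw [twistDivisor, if_pos ⟨l, hl, hx⟩]
  simp only [CompactTypeCurve.isToward_iff hl hx]

/-- The twists lower the sum of the degrees by `d` for every node. -/
lemma sum_twistDivisor (hS : S.IsRefined) :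
    ∑ j, ∑ x ∈ (S.finite_support_twistDivisor i j).toFinset, (S.twistDivisor i j x : ℤ) =
      (Fintype.card Y.Idx - 1) * d := by
  classical
  have hex : ∀ j l, Y.dualGraph.Adj j l → ∃ x : Y.comp j, Y.ι j x ∈ Set.range (Y.ι l) := by
    intro j l h
    obtain ⟨-, _, ⟨x, rfl⟩, hx⟩ := CompactTypeCurve.dualGraph_adj.mp h
    exact ⟨x, hx⟩
  choose n hn using hex
  -- `w j l` is the coefficient of the twisting divisor of `C_j` at the node on `C_l`
  let w : Y.Idx → Y.Idx → ℤ := fun j l =>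
    if h : Y.dualGraph.Adj j l then (S.twistDivisor i j (n j l h) : ℤ) else 0
  rw [← sum_sum_eq_of_leadsTo (i := i) Y.isTree w d (fun j l h => dif_neg h) ?_]
  · refine Finset.sum_congr rfl fun j _ => ?_
    have hsub : (S.finite_support_twistDivisor i j).toFinset ⊆
        (CompactTypeCurve.finite_setOf_isNode j).toFinset := by
      intro x hx
      simp only [Set.Finite.mem_toFinset, Set.mem_ofPred_eq] at hx ⊢
      exact S.isNode_of_twistDivisor_ne_zero i j hx
    rw [Finset.sum_subset hsub (fun x _ hx => by simpa using hx)]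
    have hfil : ∑ l, w j l = ∑ l ∈ Finset.univ.filter (fun l => Y.dualGraph.Adj j l), w j l :=
      (Finset.sum_subset (Finset.filter_subset _ _) fun l _ hl => dif_neg (by simpa using hl)).symm
    rw [hfil]
    symm
    have hadj : ∀ l, l ∈ Finset.univ.filter (fun l => Y.dualGraph.Adj j l) →
        Y.dualGraph.Adj j l := fun l hl => (Finset.mem_filter.mp hl).2
    refine Finset.sum_bij (fun l hl => n j l (hadj l hl)) ?_ ?_ ?_ ?_
    · intro l hl
      simp only [Set.Finite.mem_toFinset, Set.mem_ofPred_eq]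
      exact ⟨l, (hadj l hl).ne.symm, hn j l (hadj l hl)⟩
    · intro l hl l' hl' h
      obtain h1 | h1 | h1 := Y.two_branches _ j l l' ⟨_, rfl⟩ (hn j l (hadj l hl))
        (h ▸ hn j l' (hadj l' hl'))
      exacts [((hadj l hl).ne h1).elim, ((hadj l' hl').ne h1).elim, h1]
    · intro x hx
      simp only [Set.Finite.mem_toFinset, Set.mem_ofPred_eq] at hx
      obtain ⟨l, hl, hx⟩ := hx
      have h1 : Y.dualGraph.Adj j l := CompactTypeCurve.dualGraph_adj.mpr ⟨hl.symm, _, ⟨x, rfl⟩, hx⟩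
      exact ⟨l, by simpa using h1, CompactTypeCurve.eq_of_mem_range hl (hn j l _) hx⟩
    · intro l hl
      exact dif_pos (hadj l hl)
  · intro j l h
    have hadj := h.1
    have hjl : Y.ι j (n j l hadj) = Y.ι l (n l j hadj.symm) :=
      Y.meet_once j l hadj.ne ⟨⟨_, rfl⟩, hn _ _ _⟩ ⟨hn _ _ _, ⟨_, rfl⟩⟩
    have h1 : w j l = S.u j (n j l hadj) 0 := by
      rw [show w j l = _ from dif_pos hadj, S.twistDivisor_eq i j hadj.ne.symm (hn _ _ _), if_pos h]
    have h2 : w l j = S.u l (n l j hadj.symm) r := by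
      rw [show w l j = _ from dif_pos hadj.symm, S.twistDivisor_eq i l hadj.ne (hn _ _ _),
        if_neg (h.asymm Y.isTree.isAcyclic)]
    rw [h1, h2]
    exact_mod_cast hS j l _ _ hadj.ne hjl 0 (Nat.zero_le r)

lemma IsGluing.hasTotalDegree {N : Y.C.Modules} (hN : S.IsGluing i N) (hS : S.IsRefined) :
    Y.HasTotalDegree N d := by
  refine ⟨fun j => d - ∑ x ∈ (S.finite_support_twistDivisor i j).toFinset,
    (S.twistDivisor i j x : ℤ), fun j => ?_, ?_⟩
  · obtain ⟨φ⟩ := hN.2 j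
    exact HasDegree.of_iso φ.symm ((S.hasDegree j).twistDown (S.twistDivisor_isolated i j)
      (S.finite_support_twistDivisor i j))
  · rw [Finset.sum_sub_distrib, S.sum_twistDivisor i hS, Finset.sum_const, Finset.card_univ,
      nsmul_eq_mul]
    ring

/-- No node of `C_i` is one towards `C_i`, so the twisting divisor of `C_i` only involves `u_r`. -/
lemma not_isToward_self (x : Y.comp i) (hx : Y.IsNode i x) : ¬ Y.IsToward i i x := by
  obtain ⟨l, hl, hx⟩ := hx
  rw [CompactTypeCurve.isToward_iff hl hx]
  rintro ⟨-, p, hp⟩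
  exact hp p.end_mem_support

/-- The sections in `V_i` are sections of `L_{i,i}`. -/
lemma exists_twistIncl_app_eq {s : GlobalSections (Y.compStr i) (S.L i)} (hs : s ∈ S.V i) :
    ∃ t : GlobalSections (Y.compStr i) (S.twist i i),
      sectionsMap (Y.compStr i) (S.twistIncl i i) t = s := by
  refine exists_twistι_app_eq (S.L i) (S.twistDivisor i i) (U := ⊤) (t := s) fun x _ => ?_
  by_cases hx : Y.IsNode i x
  · rw [twistDivisor, if_pos hx, if_neg (not_isToward_self i x hx)]
    exact vanishesToOrder_vanishingOrder_self _ _ _ hs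
  · rw [twistDivisor, if_neg hx]
    exact vanishesToOrder_zero (L := S.L i) (U := ⊤) s trivial

lemma exists_bijOn {N : (Y.comp i).Modules} (φ : N ≅ S.twist i i) :
    ∃ W : Submodule k (GlobalSections (Y.compStr i) N), Module.finrank k W = r + 1 ∧
      Set.BijOn (sectionsMap (Y.compStr i) (φ.hom ≫ S.twistIncl i i)) W (S.V i) := by
  let lin := sectionsLinearMap (Y.compStr i) (φ.hom ≫ S.twistIncl i i)
  have hinj : Function.Injective lin := by
    have h1 := twistι_app_injective (S.L i) (S.twistDivisor i i) ⊤
    exact h1.comp (ConcreteCategory.bijective_of_isIso (φ.hom.app ⊤)).1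
  have hsurj : ∀ s ∈ S.V i, ∃ t, lin t = s := by
    intro s hs
    obtain ⟨t, rfl⟩ := S.exists_twistIncl_app_eq i hs
    obtain ⟨t', ht'⟩ := (ConcreteCategory.bijective_of_isIso (φ.hom.app ⊤)).2 t
    exact ⟨t', congrArg (sectionsMap (Y.compStr i) (S.twistIncl i i)) ht'⟩
  refine ⟨(S.V i).comap lin, ?_, fun t ht => ht, hinj.injOn, fun s hs => ?_⟩
  · rw [← S.finrank_V i, LinearEquiv.finrank_eq (Submodule.equivMapOfInjective lin hinj _),
      Submodule.map_comap_eq_of_le fun s hs => hsurj s hs]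
  · obtain ⟨t, rfl⟩ := hsurj s hs
    exact ⟨t, hs, rfl⟩

/-- A section in `V_j` of the highest order of vanishing at the node towards `C_i` is a section of
`L_{j,i}`. -/
lemma exists_section_twist_ne_zero (hij : j ≠ i) : ∃ t : Γ(S.twist i j, ⊤), t ≠ 0 := by
  obtain ⟨l, hl⟩ := exists_leadsTo Y.isTree.connected hij
  obtain ⟨hjl, _, ⟨x₀, rfl⟩, hx₀⟩ := CompactTypeCurve.dualGraph_adj.mp hl.1
  obtain ⟨s, hs, hs0, hsx⟩ :=
    exists_vanishesToOrder_vanishingOrder_zero (S.V j) x₀ r (S.finrank_V j)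
  obtain ⟨t, ht⟩ := exists_twistι_app_eq (S.L j) (S.twistDivisor i j) (U := ⊤) (t := s) (by
    intro x _
    by_cases hx : Y.IsNode j x
    · rw [twistDivisor, if_pos hx]
      split_ifs with htow
      · obtain ⟨l', hl', hx⟩ := hx
        obtain rfl := ((CompactTypeCurve.isToward_iff hl' hx).mp htow).unique Y.isTree.isAcyclic hl
        rw [CompactTypeCurve.eq_of_mem_range hl' hx hx₀]
        exact hsx
      · exact vanishesToOrder_vanishingOrder_self _ _ _ hs
    · rw [twistDivisor, if_neg hx]
      exact vanishesToOrder_zero (L := S.L j) (U := ⊤) s trivial)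
  refine ⟨t, ?_⟩
  rintro rfl
  exact hs0 (ht.symm.trans (map_zero _))

end LimitLinearSeries

end LimitSeries

theorem proposition3p1 {k : Type u} [Field k] [IsAlgClosed k]
    (Y : LimitSeries.CompactTypeCurve k) {d r : ℕ}
    (S : LimitSeries.LimitLinearSeries Y d r) (i : Y.Idx) :
    (∃ N : Y.C.Modules, S.IsGluing i N) ∧
    ∀ N : Y.C.Modules, S.IsGluing i N →
      (S.IsRefined → Y.HasTotalDegree N d) ∧
      (∀ φ : Y.restrict N i ≅ S.twist i i,
        ∃ W : Submodule k (LimitSeries.GlobalSections (Y.compStr i) (Y.restrict N i)),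
          Module.finrank k W = r + 1 ∧
          Set.BijOn (LimitSeries.sectionsMap (Y.compStr i) (φ.hom ≫ S.twistIncl i i)) W (S.V i)) ∧
      (∀ j, j ≠ i →
        ∃ s : LimitSeries.GlobalSections (Y.compStr j) (Y.restrict N j), s ≠ 0) := by
  refine ⟨S.exists_isGluing i, fun N hN => ⟨fun hS => hN.hasTotalDegree S i hS,
    fun φ => S.exists_bijOn i φ, fun j hj => ?_⟩⟩
  obtain ⟨φ⟩ := hN.2 j
  obtain ⟨t, ht⟩ := S.exists_section_twist_ne_zero i j hj
  refine ⟨φ.inv.app ⊤ t, fun h => ht ?_⟩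
  exact (ConcreteCategory.bijective_of_isIso (φ.inv.app ⊤)).1 (h.trans (map_zero _).symm)
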